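/- Let $\alpha<\tfrac12$, $\alpha\neq0$, and $1\le p\le\infty$. There is a constant $C$ depending only on $\alpha$ and $p$ such that for every real-valued $f\in L^p(0,1)$ the following holds. There is a function $u_D\in W^{2,p}_{loc}((0,1])$ (that is, $u_D\in W^{2,p}(\varepsilon,1)$ for every $\varepsilon\in(0,1)$; we use its continuous representative on $(0,1]$) such that $$-(x^{2\alpha}u_D'(x))'+u_D(x)=f(x)\ \text{ for a.e. } x\in(0,1),\qquad u_D(1)=0,\qquad \lim_{x\to0^+}u_D(x)=0.$$ It is the only function in $W^{2,p}_{loc}((0,1])$ with these properties, and it is also the only $u_D\in W^{2,p}_{loc}((0,1])$ that satisfies the equation a.e., $u_D(1)=0$, and the memberships in (i)–(iii) below. Moreover: (i) $u_D\in L^p(0,1)$ and $\|u_D\|_{L^p}\le C\|f\|_{L^p}$; (ii) $x^{2\alpha}u_D'\in W^{1,p}(0,1)$, $x^{2\alpha-1}u_D\in W^{1,p}(0,1)$ and $\|x^{2\alpha}u_D'\|_{W^{1,p}}+\|x^{2\alpha-1}u_D\|_{W^{1,p}}\le C\|f\|_{L^p}$; (iii) $x^{2\alpha}u_D\in W^{2,p}(0,1)$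 and $\|x^{2\alpha}u_D\|_{W^{2,p}}\le C\|f\|_{L^p}$; (iv) if $0<\alpha<\tfrac12$, then $u_D$, extended by $u_D(0)=0$, is in $C^{0,\frac12-\alpha}[0,1]$ with $\|u_D\|_{C^{0,\frac12-\alpha}}\le C\|f\|_{L^p}$; (v) if $\alpha<0$, then $u_D$, extended by $u_D(0)=0$, is in $C^{0,\frac12}[0,1]$ with $\|u_D\|_{C^{0,\frac12}}\le C\|f\|_{L^p}$; (vi) $|x^{2\alpha-1}u_D(x)|\le C\|f\|_{L^p}$ for all $x\in(0,1]$. -/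

import Mathlib

open MeasureTheory Set Filter Topology
open scoped ENNReal NNReal ContDiff

namespace SingularSL

/-- Lebesgue measure on the open interval `(a, b)`. -/
noncomputable abbrev vol (a b : ℝ) : Measure ℝ := volume.restrict (Ioo a b)

/-- `v` is a weak derivative of order `j` of `u` on `(a, b)`: both functions are locally integrable
on `(a, b)` and `∫ u φ⁽ʲ⁾ = (-1)ʲ ∫ v φ` for all test functions `φ ∈ C_c^∞(a, b)`. -/
structure IsWeakDeriv (j : ℕ) (a b : ℝ) (u v : ℝ → ℝ) : Prop where
  left : LocallyIntegrableOn u (Ioo a b) volume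
  right : LocallyIntegrableOn v (Ioo a b) volume
  eq : ∀ φ : ℝ → ℝ, ContDiff ℝ ∞ φ → HasCompactSupport φ → tsupport φ ⊆ Ioo a b →
    ∫ x in Ioo a b, u x * iteratedDeriv j φ x = (-1) ^ j * ∫ x in Ioo a b, v x * φ x

/-- `u ∈ W^{k,p}(a, b)`: for every `j ≤ k` a weak derivative of order `j` exists and is in `L^p`. -/
def MemSobolev (k : ℕ) (p : ℝ≥0∞) (a b : ℝ) (u : ℝ → ℝ) : Prop :=
  ∀ j ≤ k, ∃ v : ℝ → ℝ, IsWeakDeriv j a b u v ∧ MemLp v p (vol a b)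

/-- The norm `∑_{j ≤ k} ‖u⁽ʲ⁾‖_{L^p}` of `W^{k,p}(a, b)`, with values in `[0, ∞]`.
Weak derivatives of a given order are a.e. equal, so that each infimum is taken over a single value;
it is `∞` if there is no weak derivative. -/
noncomputable def sobolevNorm (k : ℕ) (p : ℝ≥0∞) (a b : ℝ) (u : ℝ → ℝ) : ℝ≥0∞ :=
  ∑ j ∈ Finset.range (k + 1), ⨅ (v : ℝ → ℝ) (_ : IsWeakDeriv j a b u v), eLpNorm v p (vol a b)

/-- `u ∈ W^{k,p}_loc((0, 1])`. -/
def MemSobolevLoc (k : ℕ) (p : ℝ≥0∞) (u : ℝ → ℝ) : Prop :=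
  ∀ ε ∈ Ioo (0 : ℝ) 1, MemSobolev k p ε 1 u

/-- The norm `sup_{[0,1]} |u| + sup_{x ≠ y} |u x - u y| / |x - y|^γ` of `C^{0,γ}[0, 1]`, with values
in `[0, ∞]`; it is finite exactly for the members of `C^{0,γ}[0, 1]`. -/
noncomputable def holderNorm (γ : ℝ) (u : ℝ → ℝ) : ℝ≥0∞ :=
  (⨆ x ∈ Icc (0 : ℝ) 1, ‖u x‖ₑ) +
    ⨆ x ∈ Icc (0 : ℝ) 1, ⨆ y ∈ Icc (0 : ℝ) 1, ⨆ _ : x ≠ y, edist (u x) (u y) / edist x y ^ γ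

/-- `u ∈ W^{2,p}_loc((0, 1])`, represented by its continuous representative on `(0, 1]` and with
weak derivative `u'`, solves `-(x^{2α} u')' + u = f` a.e. on `(0, 1)` and `u(1) = 0`. -/
structure IsSolution (α : ℝ) (p : ℝ≥0∞) (f u u' : ℝ → ℝ) : Prop where
  continuousOn : ContinuousOn u (Ioc 0 1)
  memSobolevLoc : MemSobolevLoc 2 p u
  isWeakDeriv : IsWeakDeriv 1 0 1 u u'
  equation : ∃ w' : ℝ → ℝ, IsWeakDeriv 1 0 1 (fun x => x ^ (2 * α) * u' x) w' ∧
    ∀ᵐ x ∂(vol 0 1), -w' x + u x = f x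
  right_end : u 1 = 0

end SingularSL

/-! ### Weak derivatives on an interval and primitives. -/

namespace SingularSL

/-! With `β = 1 - 2α > 0` the equation reads `-(x^{1-β} u')' = g`, where `g = f - u`. For given `g`
this integrates explicitly: the flux `W = x^{1-β} u'` is a constant minus the primitive of `g`, and
`u = ∫₀ˣ t^{β-1} W`. The weight `t^{β-1}` is integrable because `β > 0`, so `u(0) = 0` costs
nothing, and the constant is fixed by `u(1) = 0`. This gives `sol β g`.

Existence: `g ↦ sol β g` has sup norm at most `1 / (1 + β) < 1` (`abs_sol_le_of_bound`), so `u ↦ sol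
β (f - u)` is a contraction of bounded continuous functions. Its fixed point is bounded by a
multiple of `‖f‖₁` (`exists_eq_sol_sub`), hence `g = f - u` is controlled in `L^p` by `f`, and only
the explicit linear problem has to be estimated.

Regularity: `W` is bounded by `2‖g‖₁`, which gives the sup and Hölder bounds through `y^β - x^β`.
The delicate term is the derivative of `x^{-β} u`. Integration by parts (`mul_sol_eq`) cancels the
flux and leaves `-x^{-β-1} ∫₀ˣ t^β g`, a weighted average bounded in `L^p` by Hardy's inequality
(`eLpNorm_hardy_le`). Since `(x^{1-β} u)' = W + (1-β) x^{-β} u`, the same bound controls the second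
derivative in (iii).

Uniqueness: a difference of solutions solves the homogeneous equation classically inside `(0, 1)`
and vanishes at both ends, so a maximum principle makes it zero (`eq_zero_of_homogeneous`).
Membership of `x^{2α-1} v` in `W^{1,p}` bounds it, hence `v = O(x^{1-2α})` tends to zero at the
origin (`tendsto_zero_of_memSobolev`), and uniqueness in the regularity class reduces to the
Dirichlet case. -/

theorem exists_Ioo_of_isCompact {a b : ℝ} (hab : a < b) {K : Set ℝ} (hK : IsCompact K)
    (hs : K ⊆ Ioo a b) : ∃ c d, a < c ∧ c < d ∧ d < b ∧ K ⊆ Ioo c d := by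
  rcases K.eq_empty_or_nonempty with rfl | hne
  · obtain ⟨c, hc, hcb⟩ := exists_between hab
    obtain ⟨d, hd, hdb⟩ := exists_between hcb
    exact ⟨c, d, hc, hd, hdb, empty_subset _⟩
  · obtain ⟨m, hm, hml⟩ := hK.exists_isLeast hne
    obtain ⟨M, hM, hMu⟩ := hK.exists_isGreatest hne
    obtain ⟨c, hc, hcm⟩ := exists_between (hs hm).1
    obtain ⟨d, hd, hdb⟩ := exists_between (hs hM).2
    have := hml hM
    exact ⟨c, d, hc, by linarith, hdb, fun x hx => ⟨hcm.trans_le (hml hx), (hMu hx).trans_lt hd⟩⟩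

theorem integrableOn_mul_test {a b : ℝ} {u φ : ℝ → ℝ} (hu : LocallyIntegrableOn u (Ioo a b) volume)
    (hφ : Continuous φ) (hc : HasCompactSupport φ) (hs : tsupport φ ⊆ Ioo a b) :
    IntegrableOn (fun x => u x * φ x) (Ioo a b) volume := by
  have h1 : IntegrableOn u (tsupport φ) volume := hu.integrableOn_compact_subset hs hc
  have h2 : IntegrableOn (fun x => u x * φ x) (tsupport φ) volume :=
    h1.mul_continuousOn hφ.continuousOn hc
  refine IntegrableOn.integrable (Integrable.integrableOn ?_)
  rwa [integrableOn_iff_integrable_of_support_subset] at h2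
  intro x hx
  exact subset_tsupport φ fun h => hx (by simp [h])

theorem setIntegral_mul_test {a b : ℝ} {u φ : ℝ → ℝ} (hs : tsupport φ ⊆ Ioo a b) :
    ∫ x in Ioo a b, u x * φ x = ∫ x, u x * φ x := by
  apply setIntegral_eq_integral_of_forall_compl_eq_zero
  intro x hx
  rw [image_eq_zero_of_notMem_tsupport fun h => hx (hs h), mul_zero]

theorem IsWeakDeriv.congr {j : ℕ} {a b : ℝ} {u v u' v' : ℝ → ℝ} (h : IsWeakDeriv j a b u v)
    (hu : u =ᵐ[vol a b] u') (hv : v =ᵐ[vol a b] v') : IsWeakDeriv j a b u' v' where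
  left := h.left.congr hu
  right := h.right.congr hv
  eq φ h1 h2 h3 := by
    refine (integral_congr_ae ?_).trans ((h.eq φ h1 h2 h3).trans
      (congrArg _ (integral_congr_ae ?_)))
    · filter_upwards [hu] with x hx using by rw [hx]
    · filter_upwards [hv] with x hx using by rw [hx]

theorem IsWeakDeriv.congr_on {j : ℕ} {a b : ℝ} {u v u' v' : ℝ → ℝ} (h : IsWeakDeriv j a b u v)
    (hu : EqOn u u' (Ioo a b)) (hv : EqOn v v' (Ioo a b)) : IsWeakDeriv j a b u' v' :=
  h.congr ((ae_restrict_mem measurableSet_Ioo).mono hu) ((ae_restrict_mem measurableSet_Ioo).mono hv)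

theorem IsWeakDeriv.refl {a b : ℝ} {u : ℝ → ℝ} (hu : LocallyIntegrableOn u (Ioo a b) volume) :
    IsWeakDeriv 0 a b u u := ⟨hu, hu, by simp⟩

theorem IsWeakDeriv.mono {j : ℕ} {a b c d : ℝ} {u v : ℝ → ℝ} (h : IsWeakDeriv j a b u v)
    (hcd : Ioo c d ⊆ Ioo a b) : IsWeakDeriv j c d u v where
  left := h.left.mono_set hcd
  right := h.right.mono_set hcd
  eq φ h1 h2 h3 := by
    have h4 : tsupport (iteratedDeriv j φ) ⊆ tsupport φ := by
      rw [iteratedDeriv_eq_equiv_comp]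
      exact (closure_mono (Function.support_comp_subset (by simp) _)).trans
        (tsupport_iteratedFDeriv_subset j)
    have := h.eq φ h1 h2 (h3.trans hcd)
    rwa [setIntegral_mul_test (h3.trans hcd), setIntegral_mul_test (h4.trans (h3.trans hcd)),
      ← setIntegral_mul_test h3, ← setIntegral_mul_test (h4.trans h3)] at this

theorem IsWeakDeriv.sub {a b : ℝ} {u v u' v' : ℝ → ℝ} (h : IsWeakDeriv 1 a b u v)
    (h' : IsWeakDeriv 1 a b u' v') :
    IsWeakDeriv 1 a b (fun x => u x - u' x) (fun x => v x - v' x) where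
  left := h.left.sub h'.left
  right := h.right.sub h'.right
  eq φ h1 h2 h3 := by
    have e := h.eq φ h1 h2 h3
    have e' := h'.eq φ h1 h2 h3
    rw [iteratedDeriv_one] at *
    have h4 : Continuous (deriv φ) := h1.continuous_deriv (by simp)
    have h5 := (tsupport_deriv_subset (f := φ)).trans h3
    simp only [sub_mul]
    rw [integral_sub (integrableOn_mul_test h.left h4 h2.deriv h5)
      (integrableOn_mul_test h'.left h4 h2.deriv h5),
      integral_sub (integrableOn_mul_test h.right h1.continuous h2 h3)
      (integrableOn_mul_test h'.right h1.continuous h2 h3), e, e']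
    ring

theorem IsWeakDeriv.trans {a b : ℝ} {u v w : ℝ → ℝ} (h : IsWeakDeriv 1 a b u v)
    (h' : IsWeakDeriv 1 a b v w) : IsWeakDeriv 2 a b u w where
  left := h.left
  right := h'.right
  eq φ h1 h2 h3 := by
    have h4 : ContDiff ℝ ∞ (deriv φ) := (contDiff_infty_iff_deriv.1 h1).2
    have e := h.eq (deriv φ) h4 h2.deriv ((tsupport_deriv_subset (f := φ)).trans h3)
    have e' := h'.eq φ h1 h2 h3
    rw [iteratedDeriv_one] at e e'
    rw [iteratedDeriv_succ', iteratedDeriv_one, e, e']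
    ring

/-- The weight is moved onto the test function: `x^r φ` is again a test function, because `x^r` is
smooth away from `0` and the support of `φ` stays away from `0`. The product rule is then the
classical one for `x^r φ`. -/
theorem IsWeakDeriv.rpow_mul {a b : ℝ} {u v : ℝ → ℝ} (ha : 0 ≤ a) (r : ℝ)
    (h : IsWeakDeriv 1 a b u v) :
    IsWeakDeriv 1 a b (fun x => x ^ r * u x) (fun x => x ^ r * v x + r * x ^ (r - 1) * u x) := by
  have hne : ∀ x ∈ Ioo a b, x ≠ 0 := fun x hx => (ha.trans_lt hx.1).ne'
  have hcont : ∀ s : ℝ, ContinuousOn (fun x : ℝ => x ^ s) (Ioo a b) := fun s x hx =>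
    (Real.continuousAt_rpow_const x s (.inl (hne x hx))).continuousWithinAt
  have hl : ∀ (s : ℝ) {w : ℝ → ℝ}, LocallyIntegrableOn w (Ioo a b) volume →
      LocallyIntegrableOn (fun x => x ^ s * w x) (Ioo a b) volume := fun s w hw =>
    hw.continuousOn_smul isOpen_Ioo.isLocallyClosed (hcont s)
  have hl2 : LocallyIntegrableOn (fun x => r * x ^ (r - 1) * u x) (Ioo a b) volume := by
    simp_rw [mul_assoc]
    exact (hl (r - 1) h.left).smul r
  refine ⟨hl r h.left, (hl r h.right).add hl2, fun φ h1 h2 h3 => ?_⟩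
  have hts : tsupport (fun x => x ^ r * φ x) ⊆ tsupport φ := tsupport_mul_subset_right
  have hcd : ContDiff ℝ ∞ (fun x => x ^ r * φ x) := by
    refine (contMDiff_of_tsupport fun x hx => ContDiffAt.contMDiffAt ?_).contDiff
    exact (Real.contDiffAt_rpow_const_of_ne (hne x (h3 (hts hx)))).mul h1.contDiffAt
  have e := h.eq _ hcd h2.mul_left (hts.trans h3)
  have hd : ∀ x ∈ Ioo a b, deriv (fun x => x ^ r * φ x) x
      = r * x ^ (r - 1) * φ x + x ^ r * deriv φ x := fun x hx =>
    ((Real.hasDerivAt_rpow_const (.inl (hne x hx))).mul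
      (h1.differentiable (by simp) x).hasDerivAt).deriv
  rw [iteratedDeriv_one] at *
  have e2 : ∫ x in Ioo a b, u x * deriv (fun x => x ^ r * φ x) x
      = ∫ x in Ioo a b, (r * x ^ (r - 1) * u x * φ x + x ^ r * u x * deriv φ x) :=
    setIntegral_congr_fun measurableSet_Ioo fun x hx => by
      simp only [hd x hx]; ring
  rw [e2, integral_add (integrableOn_mul_test hl2 h1.continuous h2 h3)
    (integrableOn_mul_test (hl r h.left) (h1.continuous_deriv (by simp)) h2.deriv
      ((tsupport_deriv_subset (f := φ)).trans h3))] at e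
  simp only [add_mul]
  rw [integral_add (integrableOn_mul_test (hl r h.right) h1.continuous h2 h3)
    (integrableOn_mul_test hl2 h1.continuous h2 h3)]
  have e3 : ∫ x in Ioo a b, v x * (x ^ r * φ x) = ∫ x in Ioo a b, x ^ r * v x * φ x := by
    congr 1; ext x; ring
  rw [e3] at e
  linarith

theorem intervalIntegrable_of_locallyIntegrableOn {a b c d : ℝ} {g : ℝ → ℝ}
    (hg : LocallyIntegrableOn g (Ioo a b) volume) (hc : c ∈ Ioo a b) (hd : d ∈ Ioo a b) :
    IntervalIntegrable g volume c d :=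
  ((hg.integrableOn_compact_subset (ordConnected_Ioo.uIcc_subset hc hd) isCompact_uIcc)).intervalIntegrable

theorem continuousOn_primitive_Ioo {a b c : ℝ} {g : ℝ → ℝ} (hc : c ∈ Ioo a b)
    (hg : LocallyIntegrableOn g (Ioo a b) volume) :
    ContinuousOn (fun x => ∫ t in c..x, g t) (Ioo a b) := by
  intro x hx
  obtain ⟨d, e, had, hde, heb, hK⟩ := exists_Ioo_of_isCompact (hc.1.trans hc.2)
    (K := {c, x}) (by simp) (by rintro y (rfl | rfl) <;> assumption)
  have hI := intervalIntegrable_of_locallyIntegrableOn hg (c := d) (d := e) ⟨had, hde.trans heb⟩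
    ⟨had.trans hde, heb⟩
  have hcd : c ∈ Ioo d e := hK (by simp)
  have hxd : x ∈ Ioo d e := hK (by simp)
  have := (hI.absolutelyContinuousOnInterval_intervalIntegral
    (uIcc_of_le hde.le ▸ Ioo_subset_Icc_self hcd)).continuousOn
  rw [uIcc_of_le hde.le] at this
  exact (this.continuousAt (Icc_mem_nhds hxd.1 hxd.2)).continuousWithinAt

/-- The primitive is absolutely continuous on compact subintervals, so integration by parts against
`φ` is available there, and the boundary terms vanish. -/
theorem isWeakDeriv_of_primitive {a b c K : ℝ} {g U : ℝ → ℝ} (hc : c ∈ Ioo a b)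
    (hg : LocallyIntegrableOn g (Ioo a b) volume)
    (hU : ∀ x ∈ Ioo a b, U x = K + ∫ t in c..x, g t) : IsWeakDeriv 1 a b U g := by
  have key : IsWeakDeriv 1 a b (fun x => K + ∫ t in c..x, g t) g := by
    refine ⟨(continuousOn_const.add (continuousOn_primitive_Ioo hc hg)).locallyIntegrableOn measurableSet_Ioo, hg,
      fun φ h1 h2 h3 => ?_⟩
    rw [iteratedDeriv_one, setIntegral_mul_test h3,
      setIntegral_mul_test ((tsupport_deriv_subset (f := φ)).trans h3)]
    -- The base point `c` is included so that the primitive can be treated on the same compact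
    -- interval that carries `φ`.
    obtain ⟨d, e, had, hde, heb, hK⟩ := exists_Ioo_of_isCompact (hc.1.trans hc.2)
      (K := {c} ∪ tsupport φ) (isCompact_singleton.union h2)
      (by rintro y (rfl | hy); exacts [hc, h3 hy])
    have hcd : c ∈ Ioo d e := hK (by simp)
    have hI := intervalIntegrable_of_locallyIntegrableOn hg (c := d) (d := e) ⟨had, hde.trans heb⟩
      ⟨had.trans hde, heb⟩
    have hcd' : c ∈ uIcc d e := uIcc_of_le hde.le ▸ Ioo_subset_Icc_self hcd
    have hAC := hI.absolutelyContinuousOnInterval_intervalIntegral hcd'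
    have hconst : AbsolutelyContinuousOnInterval (fun _ : ℝ => K) d e :=
      contDiffOn_const.absolutelyContinuousOnInterval
    have hφ : AbsolutelyContinuousOnInterval φ d e :=
      (h1.of_le (by simp)).contDiffOn.absolutelyContinuousOnInterval
    have hsupp : ∀ {w : ℝ → ℝ} {ψ : ℝ → ℝ}, tsupport ψ ⊆ tsupport φ →
        ∫ x, w x * ψ x = ∫ x in d..e, w x * ψ x := by
      intro w ψ hψ
      refine (intervalIntegral.integral_eq_integral_of_support_subset ?_).symm
      intro x hx
      refine Ioo_subset_Ioc_self (hK (.inr (hψ (subset_tsupport ψ fun h => hx ?_))))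
      simp [h]
    rw [hsupp subset_rfl, hsupp tsupport_deriv_subset,
      (hconst.fun_add hAC).integral_mul_deriv_eq_deriv_mul hφ]
    have hz : ∀ x, x ∉ Ioo d e → φ x = 0 := fun x hx =>
      image_eq_zero_of_notMem_tsupport fun h => hx (hK (.inr h))
    rw [hz e (by simp), hz d (by simp)]
    have : ∫ x in d..e, deriv (fun x => K + ∫ t in c..x, g t) x * φ x
        = ∫ x in d..e, g x * φ x := by
      apply intervalIntegral.integral_congr_ae
      filter_upwards [hI.ae_hasDerivAt_integral] with x hx hxm
      rw [((hx (uIoc_subset_uIcc hxm) c hcd').const_add K).deriv]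
    rw [this]
    ring
  exact key.congr_on (fun x hx => (hU x hx).symm) fun _ _ => rfl

/-- Du Bois-Reymond's argument: subtracting from `φ` the multiple of a fixed bump `φ₀` with the same
integral leaves a function of mean zero, whose primitive is a test function. Testing with that
primitive shows that `∫ h φ` is a constant times `∫ φ`. -/
theorem ae_const_of_isWeakDeriv_zero {a b : ℝ} (hab : a < b) {h : ℝ → ℝ}
    (hh : IsWeakDeriv 1 a b h fun _ => 0) : ∃ K, ∀ᵐ x ∂(vol a b), h x = K := by
  obtain ⟨m, hm⟩ : (Ioo a b).Nonempty := nonempty_Ioo.2 hab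
  obtain ⟨φ₀, hs₀, hc₀, hd₀, hr₀, hm₀⟩ :=
    exists_contDiff_tsupport_subset (n := ⊤) (isOpen_Ioo.mem_nhds hm)
  have hI₀ : 0 < ∫ x, φ₀ x :=
    hd₀.continuous.integral_pos_of_hasCompactSupport_nonneg_nonzero hc₀
      (fun x => (hr₀ (mem_range_self x)).1) (x := m) (by simp [hm₀])
  refine ⟨(∫ x, h x * φ₀ x) / ∫ x, φ₀ x, ?_⟩
  set K := (∫ x, h x * φ₀ x) / ∫ x, φ₀ x with hK
  have hloc : LocallyIntegrableOn (fun x => h x - K) (Ioo a b) volume :=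
    hh.left.sub (locallyIntegrableOn_const K)
  rw [ae_restrict_iff' measurableSet_Ioo]
  suffices ∀ᵐ x, x ∈ Ioo a b → h x - K = 0 from this.mono fun x hx hxm => by
    linarith [hx hxm]
  refine isOpen_Ioo.ae_eq_zero_of_integral_contDiff_smul_eq_zero hloc fun φ hφ hφc hφs => ?_
  set s := (∫ x, φ x) / ∫ x, φ₀ x with hs
  set χ : ℝ → ℝ := fun x => φ x - s * φ₀ x with hχ
  have hχd : ContDiff ℝ ∞ χ := hφ.sub (contDiff_const.mul hd₀)
  obtain ⟨c, d, hac, hcd, hdb, hsub⟩ := exists_Ioo_of_isCompact hab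
    (hφc.isCompact.union hc₀.isCompact) (union_subset hφs hs₀)
  have hχ0 : ∀ x, x ∉ Ioo c d → χ x = 0 := fun x hx => by
    simp only [hχ]
    rw [image_eq_zero_of_notMem_tsupport fun h => hx (hsub (.inl h)),
      image_eq_zero_of_notMem_tsupport fun h => hx (hsub (.inr h))]
    simp
  have hiφ : Integrable φ := hφ.continuous.integrable_of_hasCompactSupport hφc
  have hiφ₀ : Integrable φ₀ := hd₀.continuous.integrable_of_hasCompactSupport hc₀
  have hχi : ∫ x, χ x = 0 := by
    simp only [hχ]
    rw [integral_sub hiφ (hiφ₀.const_mul s), integral_const_mul, hs]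
    field_simp
    simp
  set ψ : ℝ → ℝ := fun x => ∫ t in c..x, χ t with hψ
  have hψd : ∀ x, HasDerivAt ψ (χ x) x := fun x =>
    intervalIntegral.integral_hasDerivAt_right (hχd.continuous.intervalIntegrable _ _)
      hχd.continuous.stronglyMeasurable.stronglyMeasurableAtFilter hχd.continuous.continuousAt
  have hderiv : deriv ψ = χ := funext fun x => (hψd x).deriv
  have hψc : ContDiff ℝ ∞ ψ :=
    contDiff_infty_iff_deriv.2 ⟨fun x => (hψd x).differentiableAt, hderiv ▸ hχd⟩
  -- To the left of `c` the integrand vanishes; to the right of `d` the whole mass of `χ` has been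
  -- collected, and it is zero.
  have hψ0 : ∀ x, x ∉ Icc c d → ψ x = 0 := by
    intro x hx
    rcases lt_or_ge x c with hxc | hxc
    · refine (intervalIntegral.integral_congr (g := fun _ => 0) fun t ht => ?_).trans (by simp)
      rw [uIcc_of_ge hxc.le] at ht
      exact hχ0 t fun h => absurd ht.2 (not_le.2 h.1)
    · have hxd : d < x := not_le.1 fun h => hx ⟨hxc, h⟩
      rw [hψ]
      simp only
      rw [intervalIntegral.integral_eq_integral_of_support_subset, hχi]
      intro t ht
      by_contra h
      exact ht (hχ0 t fun h' => h ⟨h'.1, h'.2.le.trans hxd.le⟩)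
  have hψt : tsupport ψ ⊆ Icc c d :=
    closure_minimal (fun x hx => by_contra fun h => hx (hψ0 x h)) isClosed_Icc
  have hψcs : HasCompactSupport ψ := isCompact_Icc.of_isClosed_subset (isClosed_tsupport _) hψt
  have e := hh.eq ψ hψc hψcs (hψt.trans (Icc_subset_Ioo hac hdb))
  rw [iteratedDeriv_one, hderiv] at e
  simp only [zero_mul, integral_zero, mul_zero] at e
  have i1 := integrableOn_mul_test hh.left hφ.continuous hφc hφs
  have i2 := integrableOn_mul_test hh.left hd₀.continuous hc₀ hs₀
  have e' : ∫ x in Ioo a b, (h x * φ x - s * (h x * φ₀ x)) = 0 := by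
    rw [← e]; congr 1; ext x; simp only [hχ]; ring
  rw [integral_sub i1 (i2.const_mul s), integral_const_mul, setIntegral_mul_test hφs,
    setIntegral_mul_test hs₀] at e'
  have i1' : Integrable (fun x => h x * φ x) := by
    refine (integrableOn_iff_integrable_of_support_subset ?_).1 i1
    intro x hx
    exact hφs (subset_tsupport φ fun h => hx (by simp [h]))
  have : ∫ x, φ x • (h x - K) = (∫ x, h x * φ x) - K * ∫ x, φ x := by
    rw [← integral_const_mul, ← integral_sub i1' (hiφ.const_mul K)]
    congr 1; ext x; simp only [smul_eq_mul]; ring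
  rw [this, hK]
  rw [hs] at e'
  field_simp at e' ⊢
  linarith

theorem IsWeakDeriv.ae_eq_primitive {a b c : ℝ} (hc : c ∈ Ioo a b) {U g : ℝ → ℝ}
    (h : IsWeakDeriv 1 a b U g) : ∃ K, ∀ᵐ x ∂(vol a b), U x = K + ∫ t in c..x, g t := by
  obtain ⟨K, hK⟩ := ae_const_of_isWeakDeriv_zero (hc.1.trans hc.2) <|
    (h.sub (isWeakDeriv_of_primitive (K := 0) hc h.right fun x _ => rfl)).congr_on
      (fun _ _ => rfl) (fun x _ => sub_self (g x))
  exact ⟨K, hK.mono fun x hx => by linarith⟩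

end SingularSL

/-! ### Uniqueness by a maximum principle, and decay at the origin. -/

namespace SingularSL

/-- At a positive interior maximum `x₀` the flux `Y` vanishes. Since `Y' = z > 0` nearby, `Y` is
positive just to the right of `x₀`, so `z` increases strictly beyond its maximum. Only first
derivatives of `z` and `Y` are needed. -/
theorem nonpos_of_classical_homogeneous {z Y ρ : ℝ → ℝ} (hρ : ∀ x ∈ Ioo (0 : ℝ) 1, 0 < ρ x)
    (hc : ContinuousOn z (Ioc 0 1)) (h0 : Tendsto z (𝓝[>] 0) (𝓝 0)) (h1 : z 1 = 0)
    (hz : ∀ x ∈ Ioo (0 : ℝ) 1, HasDerivAt z (ρ x * Y x) x)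
    (hY : ∀ x ∈ Ioo (0 : ℝ) 1, HasDerivAt Y (z x) x) : ∀ x ∈ Ioo (0 : ℝ) 1, z x ≤ 0 := by
  by_contra! ⟨x₁, hx₁, hpos⟩
  -- The limit at `0` serves as boundary value, so that a maximum is attained on the compact
  -- interval.
  have hcu : ContinuousOn (Function.update z 0 0) (Icc 0 1) := by
    rw [continuousOn_update_iff, Icc_sdiff_left]
    exact ⟨hc, fun _ => h0.mono_left (nhdsWithin_mono _ Ioc_subset_Ioi_self)⟩
  obtain ⟨x₀, hx₀, hmax⟩ := isCompact_Icc.exists_isMaxOn (nonempty_Icc.2 zero_le_one) hcu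
  have hle : ∀ x ∈ Ioc (0 : ℝ) 1, z x ≤ Function.update z 0 0 x₀ := fun x hx => by
    simpa [hx.1.ne'] using hmax (Ioc_subset_Icc_self hx)
  have hpos' := hpos.trans_le (hle x₁ (Ioo_subset_Ioc_self hx₁))
  have hne0 : x₀ ≠ 0 := by rintro rfl; simp at hpos'
  have hne1 : x₀ ≠ 1 := by rintro rfl; simp [h1] at hpos'
  rw [Function.update_of_ne hne0] at hle hpos'
  have hm : x₀ ∈ Ioo (0 : ℝ) 1 := ⟨hx₀.1.lt_of_ne' hne0, hx₀.2.lt_of_ne hne1⟩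
  have hloc : IsLocalMax z x₀ := by
    filter_upwards [isOpen_Ioo.mem_nhds hm] with x hx using hle x (Ioo_subset_Ioc_self hx)
  have hY0 : Y x₀ = 0 := by
    have := hloc.hasDerivAt_eq_zero (hz x₀ hm)
    exact (mul_eq_zero.1 this).resolve_left (hρ x₀ hm).ne'
  obtain ⟨ε, hε, hball⟩ := Metric.mem_nhds_iff.1
    (inter_mem (isOpen_Ioo.mem_nhds hm) ((hz x₀ hm).continuousAt.eventually_const_lt hpos'))
  have hsub : Icc x₀ (x₀ + ε / 2) ⊆ Metric.ball x₀ ε := fun x hx => by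
    rw [Metric.mem_ball, Real.dist_eq, abs_lt]; constructor <;> linarith [hx.1, hx.2]
  have hlt : x₀ < x₀ + ε / 2 := by linarith
  have hYm : StrictMonoOn Y (Icc x₀ (x₀ + ε / 2)) := by
    apply strictMonoOn_of_deriv_pos (convex_Icc _ _)
    · exact fun x hx => (hY x (hball (hsub hx)).1).continuousAt.continuousWithinAt
    · intro x hx
      have := hball (hsub (interior_subset hx))
      rw [(hY x this.1).deriv]
      exact this.2
  have hzm : StrictMonoOn z (Icc x₀ (x₀ + ε / 2)) := by
    apply strictMonoOn_of_deriv_pos (convex_Icc _ _)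
    · exact fun x hx => (hz x (hball (hsub hx)).1).continuousAt.continuousWithinAt
    · intro x hx
      have hx' := hball (hsub (interior_subset hx))
      rw [(hz x hx'.1).deriv]
      rw [interior_Icc] at hx
      have := hYm (left_mem_Icc.2 hlt.le) (Ioo_subset_Icc_self hx) hx.1
      exact mul_pos (hρ x hx'.1) (hY0 ▸ this)
  have h2 := hzm (left_mem_Icc.2 hlt.le) (right_mem_Icc.2 hlt.le) hlt
  have h3 := hle (x₀ + ε / 2) (Ioo_subset_Ioc_self (hball (hsub (right_mem_Icc.2 hlt.le))).1)
  linarith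

theorem hasDerivAt_primitive_Ioo {a b c x : ℝ} {g : ℝ → ℝ} (hg : ContinuousOn g (Ioo a b))
    (hc : c ∈ Ioo a b) (hx : x ∈ Ioo a b) (K : ℝ) :
    HasDerivAt (fun y => K + ∫ t in c..y, g t) (g x) x := by
  refine HasDerivAt.const_add K (intervalIntegral.integral_hasDerivAt_right
    ((hg.mono (ordConnected_Ioo.uIcc_subset hc hx)).intervalIntegrable) ?_
    (hg.continuousAt (isOpen_Ioo.mem_nhds hx)))
  exact hg.stronglyMeasurableAtFilter isOpen_Ioo x hx

theorem IsWeakDeriv.eqOn_primitive {a b c : ℝ} (hc : c ∈ Ioo a b) {U g : ℝ → ℝ}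
    (h : IsWeakDeriv 1 a b U g) (hU : ContinuousOn U (Ioo a b)) :
    ∃ K, EqOn U (fun x => K + ∫ t in c..x, g t) (Ioo a b) := by
  obtain ⟨K, hK⟩ := h.ae_eq_primitive hc
  exact ⟨K, Measure.eqOn_open_of_ae_eq hK isOpen_Ioo hU
    (continuousOn_const.add (continuousOn_primitive_Ioo hc h.right))⟩

/-- Bootstrapping from weak to classical: the flux agrees a.e. with a primitive `Y` of the
continuous `z`, so `z' = x^{-2α} Y` a.e. has a continuous representative and `z` is `C¹` inside. The
maximum principle then applies to `z` and to `-z`. -/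
theorem eq_zero_of_homogeneous {α : ℝ} {z z' : ℝ → ℝ} (hc : ContinuousOn z (Ioc 0 1))
    (hd : IsWeakDeriv 1 0 1 z z') (hW : IsWeakDeriv 1 0 1 (fun x => x ^ (2 * α) * z' x) z)
    (h0 : Tendsto z (𝓝[>] 0) (𝓝 0)) (h1 : z 1 = 0) : ∀ x ∈ Ioc (0 : ℝ) 1, z x = 0 := by
  have hhalf : (1 / 2 : ℝ) ∈ Ioo (0 : ℝ) 1 := by norm_num
  have hco := hc.mono Ioo_subset_Ioc_self
  obtain ⟨K, hK⟩ := hW.ae_eq_primitive hhalf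
  set Y : ℝ → ℝ := fun x => K + ∫ t in (1 / 2)..x, z t with hYdef
  have hY : ∀ x ∈ Ioo (0 : ℝ) 1, HasDerivAt Y (z x) x := fun x hx =>
    hasDerivAt_primitive_Ioo hco hhalf hx K
  have hρ : ∀ x ∈ Ioo (0 : ℝ) 1, 0 < x ^ (-(2 * α)) := fun x hx => Real.rpow_pos_of_pos hx.1 _
  have hg : ContinuousOn (fun x => x ^ (-(2 * α)) * Y x) (Ioo 0 1) := fun x hx =>
    ((Real.continuousAt_rpow_const x _ (.inl hx.1.ne')).mul
      (hY x hx).continuousAt).continuousWithinAt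
  have hd' : IsWeakDeriv 1 0 1 z (fun x => x ^ (-(2 * α)) * Y x) := by
    refine hd.congr (.refl _ _) ?_
    filter_upwards [hK, ae_restrict_mem measurableSet_Ioo] with x hx hxm
    change _ = Y x at hx
    rw [← hx, ← mul_assoc, ← Real.rpow_add hxm.1]
    simp
  obtain ⟨K', hK'⟩ := hd'.eqOn_primitive hhalf hco
  have hz : ∀ x ∈ Ioo (0 : ℝ) 1, HasDerivAt z (x ^ (-(2 * α)) * Y x) x := fun x hx =>
    (hasDerivAt_primitive_Ioo hg hhalf hx K').congr_of_eventuallyEq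
      (hK'.eventuallyEq_of_mem (isOpen_Ioo.mem_nhds hx))
  have hle := nonpos_of_classical_homogeneous hρ hc h0 h1 hz hY
  have hge := nonpos_of_classical_homogeneous (z := -z) (Y := -Y) hρ hc.neg (by simpa using! h0.neg)
    (by simp [h1]) (fun x hx => by simpa using (hz x hx).neg) (fun x hx => (hY x hx).neg)
  intro x hx
  rcases hx.2.eq_or_lt with rfl | hx1
  · exact h1
  · exact le_antisymm (hle x ⟨hx.1, hx1⟩) (by simpa using hge x ⟨hx.1, hx1⟩)

theorem IsSolution.eqOn {α : ℝ} {p : ℝ≥0∞} {f u u' v v' : ℝ → ℝ} (hu : IsSolution α p f u u')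
    (hv : IsSolution α p f v v') (hu0 : Tendsto u (𝓝[>] 0) (𝓝 0))
    (hv0 : Tendsto v (𝓝[>] 0) (𝓝 0)) : EqOn v u (Ioc 0 1) := by
  obtain ⟨wu, hwu, heu⟩ := hu.equation
  obtain ⟨wv, hwv, hev⟩ := hv.equation
  have hW : IsWeakDeriv 1 0 1 (fun x => x ^ (2 * α) * (v' x - u' x)) (fun x => v x - u x) := by
    refine (hwv.sub hwu).congr (.of_forall fun x => by ring) ?_
    filter_upwards [heu, hev] with x h1 h2
    linarith
  have := eq_zero_of_homogeneous (hv.continuousOn.sub hu.continuousOn)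
    (hv.isWeakDeriv.sub hu.isWeakDeriv) hW (by simpa using! hv0.sub hu0)
    (by simp [hv.right_end, hu.right_end])
  exact fun x hx => sub_eq_zero.1 (this x hx)

/-- Total mass one makes `L^p` norms monotone in `p` with constant one. -/
instance : IsProbabilityMeasure (vol 0 1) := ⟨by simp⟩

theorem tendsto_zero_of_memSobolev {α : ℝ} (hα : α < 1 / 2) {p : ℝ≥0∞} (hp : 1 ≤ p) {v : ℝ → ℝ}
    (hc : ContinuousOn v (Ioc 0 1)) (h : MemSobolev 1 p 0 1 (fun x => x ^ (2 * α - 1) * v x)) :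
    Tendsto v (𝓝[>] 0) (𝓝 0) := by
  obtain ⟨r, hr, hrp⟩ := h 1 le_rfl
  have hri : IntegrableOn r (Ioo 0 1) volume := hrp.integrable hp
  have hhalf : (1 / 2 : ℝ) ∈ Ioo (0 : ℝ) 1 := by norm_num
  obtain ⟨K, hK⟩ := hr.eqOn_primitive hhalf fun x hx =>
    (Real.continuousAt_rpow_const x _ (.inl hx.1.ne')).continuousWithinAt.mul
      ((hc.mono Ioo_subset_Ioc_self) x hx)
  -- A function with integrable weak derivative on a bounded interval is bounded; `B` is such a
  -- bound for `x^{2α-1} v`.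
  set B := |K| + ∫ t in Ioo 0 1, |r t| with hB
  have hbd : ∀ x ∈ Ioo (0 : ℝ) 1, |v x| ≤ B * x ^ (1 - 2 * α) := by
    intro x hx
    have h1 : |∫ t in (1 / 2)..x, r t| ≤ ∫ t in Ioo 0 1, |r t| := by
      refine (intervalIntegral.norm_integral_le_integral_norm_uIoc (f := r)).trans ?_
      exact setIntegral_mono_set hri.norm (.of_forall fun _ => norm_nonneg _)
        (uIoc_subset_uIcc.trans (ordConnected_Ioo.uIcc_subset hhalf hx)).eventuallyLE
    have h2 : |x ^ (2 * α - 1) * v x| ≤ B := by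
      have h4 : x ^ (2 * α - 1) * v x = K + ∫ t in (1 / 2)..x, r t := hK hx
      rw [h4]
      exact (abs_add_le _ _).trans (by linarith)
    have h3 : v x = (x ^ (2 * α - 1) * v x) * x ^ (1 - 2 * α) := by
      rw [mul_right_comm, ← Real.rpow_add hx.1]; simp
    rw [h3, abs_mul, abs_of_pos (Real.rpow_pos_of_pos hx.1 _)]
    exact mul_le_mul_of_nonneg_right h2 (Real.rpow_pos_of_pos hx.1 _).le
  have hlim : Tendsto (fun x : ℝ => B * x ^ (1 - 2 * α)) (𝓝[>] 0) (𝓝 0) := by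
    have := ((Real.continuous_rpow_const (q := 1 - 2 * α) (by linarith)).const_mul B).tendsto 0
    rw [Real.zero_rpow (by linarith), mul_zero] at this
    exact this.mono_left nhdsWithin_le_nhds
  refine squeeze_zero_norm' ?_ hlim
  filter_upwards [Ioo_mem_nhdsGT one_pos] with x hx using hbd x hx

end SingularSL

/-! ### The explicit solution operator and the fixed point. -/

namespace SingularSL

/-- The flux `x^{1-β} u'` of the solution `u` of `-(x^{1-β} u')' = g`, `u(0) = u(1) = 0`. -/
noncomputable def flux (β : ℝ) (g : ℝ → ℝ) (x : ℝ) : ℝ :=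
  β * (∫ t in (0 : ℝ)..1, t ^ (β - 1) * ∫ s in (0 : ℝ)..t, g s) - ∫ s in (0 : ℝ)..x, g s

/-- The solution `u` of `-(x^{1-β} u')' = g`, `u(0) = u(1) = 0`. -/
noncomputable def sol (β : ℝ) (g : ℝ → ℝ) (x : ℝ) : ℝ :=
  ∫ t in (0 : ℝ)..x, t ^ (β - 1) * flux β g t

variable {β : ℝ} {g h : ℝ → ℝ}

theorem mem_uIcc_zero_one {x : ℝ} (hx : x ∈ Icc (0 : ℝ) 1) : x ∈ uIcc (0 : ℝ) 1 := by
  rwa [uIcc_of_le zero_le_one]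

theorem intervalIntegrable_of_zero_one (hg : IntervalIntegrable g volume 0 1) {x y : ℝ}
    (hx : x ∈ Icc (0 : ℝ) 1) (hy : y ∈ Icc (0 : ℝ) 1) : IntervalIntegrable g volume x y :=
  hg.mono_set (uIcc_subset_uIcc (mem_uIcc_zero_one hx) (mem_uIcc_zero_one hy))

theorem continuousOn_primitive_zero_one (hg : IntervalIntegrable g volume 0 1) :
    ContinuousOn (fun x => ∫ s in (0 : ℝ)..x, g s) (Icc 0 1) := by
  have := (hg.absolutelyContinuousOnInterval_intervalIntegral (c := 0) (by simp)).continuousOn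
  rwa [uIcc_of_le zero_le_one] at this

theorem abs_primitive_le (hg : IntervalIntegrable g volume 0 1) {x : ℝ} (hx : x ∈ Icc (0 : ℝ) 1) :
    |∫ s in (0 : ℝ)..x, g s| ≤ ∫ s in (0 : ℝ)..1, |g s| := by
  refine (intervalIntegral.abs_integral_le_integral_abs hx.1).trans ?_
  exact intervalIntegral.integral_mono_interval le_rfl hx.1 hx.2
    (.of_forall fun _ => abs_nonneg _) hg.abs

theorem intervalIntegrable_weight (hβ : 0 < β) (x y : ℝ) :
    IntervalIntegrable (fun t : ℝ => t ^ (β - 1)) volume x y :=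
  intervalIntegral.intervalIntegrable_rpow' (by linarith)

theorem intervalIntegrable_weight_mul (hβ : 0 < β) (hh : ContinuousOn h (Icc 0 1)) {x y : ℝ}
    (hx : x ∈ Icc (0 : ℝ) 1) (hy : y ∈ Icc (0 : ℝ) 1) :
    IntervalIntegrable (fun t : ℝ => t ^ (β - 1) * h t) volume x y :=
  (intervalIntegrable_weight hβ x y).mul_continuousOn
    (hh.mono (ordConnected_Icc.uIcc_subset hx hy))

theorem integral_weight (hβ : 0 < β) (x y : ℝ) :
    ∫ t in x..y, t ^ (β - 1) = (y ^ β - x ^ β) / β := by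
  rw [integral_rpow (.inl (by linarith))]; simp

theorem abs_integral_weight_mul_le (hβ : 0 < β) {m : ℝ} {x y : ℝ} (h0 : 0 ≤ x) (hxy : x ≤ y)
    (hh : ∀ t ∈ Ioc x y, |h t| ≤ m) :
    |∫ t in x..y, t ^ (β - 1) * h t| ≤ m * ((y ^ β - x ^ β) / β) := by
  rw [← integral_weight hβ, ← intervalIntegral.integral_const_mul]
  refine intervalIntegral.norm_integral_le_of_norm_le (f := fun t => t ^ (β - 1) * h t)
    hxy (.of_forall fun t ht => ?_)
    ((intervalIntegrable_weight hβ x y).const_mul m)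
  rw [norm_mul, Real.norm_eq_abs, Real.norm_eq_abs,
    abs_of_nonneg (Real.rpow_nonneg (h0.trans ht.1.le) _), mul_comm]
  exact mul_le_mul_of_nonneg_right (hh t ht) (Real.rpow_nonneg (h0.trans ht.1.le) _)

theorem continuousOn_flux (hg : IntervalIntegrable g volume 0 1) :
    ContinuousOn (flux β g) (Icc 0 1) :=
  continuousOn_const.sub (continuousOn_primitive_zero_one hg)

/-- The constant part and the primitive contribute `‖g‖₁` each: the factor `β` cancels `∫₀¹ t^{β-1}
= 1 / β`. -/
theorem abs_flux_le (hβ : 0 < β) (hg : IntervalIntegrable g volume 0 1) {x : ℝ}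
    (hx : x ∈ Icc (0 : ℝ) 1) : |flux β g x| ≤ 2 * ∫ s in (0 : ℝ)..1, |g s| := by
  have h1 := abs_primitive_le hg hx
  have h2 := abs_integral_weight_mul_le hβ (h := fun t => ∫ s in (0 : ℝ)..t, g s) le_rfl
    zero_le_one fun t ht => abs_primitive_le hg (Ioc_subset_Icc_self ht)
  rw [Real.one_rpow, Real.zero_rpow hβ.ne', sub_zero, mul_one_div, le_div_iff₀ hβ] at h2
  rw [flux]
  refine (abs_sub _ _).trans ?_
  rw [abs_mul, abs_of_pos hβ]
  linarith

theorem sol_zero : sol β g 0 = 0 := by simp [sol]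

/-- Integrating the constant part of the flux produces `x^β`. In this form the vanishing at `1` is
visible, and the two terms can be combined with cancellation in the sup norm estimate. -/
theorem sol_eq (hβ : 0 < β) (hg : IntervalIntegrable g volume 0 1) {x : ℝ}
    (hx : x ∈ Icc (0 : ℝ) 1) :
    sol β g x = x ^ β * (∫ t in (0 : ℝ)..1, t ^ (β - 1) * ∫ s in (0 : ℝ)..t, g s)
      - ∫ t in (0 : ℝ)..x, t ^ (β - 1) * ∫ s in (0 : ℝ)..t, g s := by
  simp only [sol, flux, mul_sub]
  rw [intervalIntegral.integral_sub ((intervalIntegrable_weight hβ 0 x).mul_const _)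
    (intervalIntegrable_weight_mul hβ (continuousOn_primitive_zero_one hg) (by simp) hx),
    intervalIntegral.integral_mul_const, integral_weight hβ, Real.zero_rpow hβ.ne']
  field_simp
  simp

theorem sol_one (hβ : 0 < β) (hg : IntervalIntegrable g volume 0 1) : sol β g 1 = 0 := by
  rw [sol_eq hβ hg (by simp)]; simp

theorem sol_sub_sol (hβ : 0 < β) (hg : IntervalIntegrable g volume 0 1) {x y : ℝ}
    (hx : x ∈ Icc (0 : ℝ) 1) (hy : y ∈ Icc (0 : ℝ) 1) :
    sol β g y - sol β g x = ∫ t in x..y, t ^ (β - 1) * flux β g t :=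
  intervalIntegral.integral_interval_sub_left
    (intervalIntegrable_weight_mul hβ (continuousOn_flux hg) (by simp) hy)
    (intervalIntegrable_weight_mul hβ (continuousOn_flux hg) (by simp) hx)

theorem abs_sol_sub_sol_le (hβ : 0 < β) (hg : IntervalIntegrable g volume 0 1) {x y : ℝ}
    (hx : 0 ≤ x) (hxy : x ≤ y) (hy : y ≤ 1) :
    |sol β g y - sol β g x| ≤ (2 * ∫ s in (0 : ℝ)..1, |g s|) * ((y ^ β - x ^ β) / β) := by
  rw [sol_sub_sol hβ hg ⟨hx, hxy.trans hy⟩ ⟨hx.trans hxy, hy⟩]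
  exact abs_integral_weight_mul_le hβ hx hxy fun t ht =>
    abs_flux_le hβ hg ⟨hx.trans ht.1.le, ht.2.trans hy⟩

theorem abs_sol_le (hβ : 0 < β) (hg : IntervalIntegrable g volume 0 1) {x : ℝ}
    (hx : x ∈ Icc (0 : ℝ) 1) :
    |sol β g x| ≤ (2 * ∫ s in (0 : ℝ)..1, |g s|) * (x ^ β / β) := by
  simpa [sol_zero, Real.zero_rpow hβ.ne'] using abs_sol_sub_sol_le hβ hg le_rfl hx.1 hx.2

theorem continuousOn_sol (hβ : 0 < β) (hg : IntervalIntegrable g volume 0 1) :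
    ContinuousOn (sol β g) (Icc 0 1) :=
  continuousOn_primitive_zero_one
    (intervalIntegrable_weight_mul hβ (continuousOn_flux hg) (by simp) (by simp))

/-- `-(x^{1-β} u')' = g` is solved by `sol β g` with the sup norm bound `1 / (1 + β) < 1`. -/
theorem abs_sol_le_of_bound (hβ : 0 < β) (hg : IntervalIntegrable g volume 0 1) {m : ℝ}
    (hm : ∀ t ∈ Icc (0 : ℝ) 1, |g t| ≤ m) {x : ℝ} (hx : x ∈ Icc (0 : ℝ) 1) :
    |sol β g x| ≤ 1 / (1 + β) * m := by
  have hm0 : 0 ≤ m := (abs_nonneg _).trans (hm 0 (by simp))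
  -- The primitive of `g` is at most `m t`. The extra factor `t` is traded for the weight `t^β`,
  -- which is why the weight lemma is applied with `β + 1` below.
  have hP : ∀ t ∈ Ioc (0 : ℝ) 1, |(∫ s in (0 : ℝ)..t, g s) / t| ≤ m := by
    intro t ht
    rw [abs_div, abs_of_pos ht.1, div_le_iff₀ ht.1]
    have := intervalIntegral.norm_integral_le_of_norm_le_const (a := 0) (b := t) (f := g) (C := m)
      fun s hs => by
        rw [uIoc_of_le ht.1.le] at hs
        exact hm s ⟨hs.1.le, hs.2.trans ht.2⟩
    simpa [abs_of_pos ht.1] using this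
  have hw : ∀ x y : ℝ, 0 ≤ x → x ≤ y → y ≤ 1 →
      |∫ t in x..y, t ^ (β - 1) * ∫ s in (0 : ℝ)..t, g s|
        ≤ m * ((y ^ (β + 1) - x ^ (β + 1)) / (β + 1)) := by
    intro x y h0 hxy h1
    have := abs_integral_weight_mul_le (β := β + 1) (by linarith)
      (h := fun t => (∫ s in (0 : ℝ)..t, g s) / t) h0 hxy
      fun t ht => hP t ⟨h0.trans_lt ht.1, ht.2.trans h1⟩
    convert! this using 2
    refine intervalIntegral.integral_congr_ae (.of_forall fun t ht => ?_)
    rw [uIoc_of_le hxy] at ht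
    have ht0 : 0 < t := h0.trans_lt ht.1
    rw [add_sub_cancel_right, Real.rpow_sub_one ht0.ne']
    ring
  have h1 := hw 0 x le_rfl hx.1 hx.2
  have h2 := hw x 1 hx.1 hx.2 le_rfl
  rw [sol_eq hβ hg hx, ← intervalIntegral.integral_add_adjacent_intervals
    (intervalIntegrable_weight_mul hβ (continuousOn_primitive_zero_one hg) (by simp) hx)
    (intervalIntegrable_weight_mul hβ (continuousOn_primitive_zero_one hg) hx (by simp))]
  set I := ∫ t in (0 : ℝ)..x, t ^ (β - 1) * ∫ s in (0 : ℝ)..t, g s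
  set J := ∫ t in x..1, t ^ (β - 1) * ∫ s in (0 : ℝ)..t, g s
  have ha0 : 0 ≤ x ^ β := Real.rpow_nonneg hx.1 _
  have ha1 : x ^ β ≤ 1 := Real.rpow_le_one hx.1 hx.2 hβ.le
  have hb : x ^ (β + 1) = x ^ β * x := Real.rpow_add_one' hx.1 (by linarith)
  rw [Real.zero_rpow (by linarith), sub_zero, hb] at h1
  rw [Real.one_rpow, hb] at h2
  set a := x ^ β
  have hax : 0 ≤ a * x := mul_nonneg ha0 hx.1
  -- Regrouping as `a J - (1 - a) I` keeps the cancellation between the two copies of `I`;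
  -- estimating them separately would lose the contraction constant.
  have h3 : |a * (I + J) - I| ≤ (1 - a) * |I| + a * |J| := by
    rw [show a * (I + J) - I = a * J - (1 - a) * I by ring]
    refine (abs_sub _ _).trans ?_
    rw [abs_mul, abs_mul, abs_of_nonneg ha0, abs_of_nonneg (sub_nonneg.2 ha1)]
    linarith
  refine h3.trans ?_
  have h4 : (1 - a) * |I| + a * |J| ≤ (1 - a) * (m * (a * x / (β + 1)))
      + a * (m * ((1 - a * x) / (β + 1))) :=
    add_le_add (mul_le_mul_of_nonneg_left h1 (sub_nonneg.2 ha1)) (mul_le_mul_of_nonneg_left h2 ha0)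
  refine h4.trans ?_
  have h5 : (1 - a) * (m * (a * x / (β + 1))) + a * (m * ((1 - a * x) / (β + 1)))
      = m / (β + 1) * (a + a * x * (1 - 2 * a)) := by ring
  have h6 : 1 / (1 + β) * m = m / (β + 1) * 1 := by rw [add_comm]; ring
  rw [h5, h6]
  refine mul_le_mul_of_nonneg_left ?_ (by positivity)
  -- It remains to see `a + a x (1 - 2a) ≤ 1`: for `a ≥ 1/2` the second term is nonpositive,
  -- otherwise `x ≤ 1` gives `2a - 2a² ≤ 1`.
  rcases le_total (1 - 2 * a) 0 with h | h
  · linarith [mul_nonpos_of_nonneg_of_nonpos hax h]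
  · have : a * x * (1 - 2 * a) ≤ a * 1 * (1 - 2 * a) := by gcongr; exact hx.2
    nlinarith

theorem sol_sub (hβ : 0 < β) (hg : IntervalIntegrable g volume 0 1)
    (hh : IntervalIntegrable h volume 0 1) {x : ℝ} (hx : x ∈ Icc (0 : ℝ) 1) :
    sol β (fun t => g t - h t) x = sol β g x - sol β h x := by
  have hi : ∀ y ∈ Icc (0 : ℝ) 1,
      ∫ t in (0 : ℝ)..y, t ^ (β - 1) * ∫ s in (0 : ℝ)..t, (g s - h s)
        = (∫ t in (0 : ℝ)..y, t ^ (β - 1) * ∫ s in (0 : ℝ)..t, g s)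
          - ∫ t in (0 : ℝ)..y, t ^ (β - 1) * ∫ s in (0 : ℝ)..t, h s := by
    intro y hy
    rw [← intervalIntegral.integral_sub
      (intervalIntegrable_weight_mul hβ (continuousOn_primitive_zero_one hg) (by simp) hy)
      (intervalIntegrable_weight_mul hβ (continuousOn_primitive_zero_one hh) (by simp) hy)]
    refine intervalIntegral.integral_congr fun t ht => ?_
    have ht' : t ∈ Icc (0 : ℝ) 1 := ordConnected_Icc.uIcc_subset (by simp) hy ht
    rw [intervalIntegral.integral_sub (intervalIntegrable_of_zero_one hg (by simp) ht')
      (intervalIntegrable_of_zero_one hh (by simp) ht'), mul_sub]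
  rw [sol_eq hβ (hg.sub hh) hx, sol_eq hβ hg hx, sol_eq hβ hh hx]
  simp only [hi x hx, hi 1 (by simp)]
  ring

open BoundedContinuousFunction in
/-- The nonlocal equation `u = sol β (f - u)`, solved by a contraction argument. -/
theorem exists_eq_sol_sub (hβ : 0 < β) {f : ℝ → ℝ} (hf : IntervalIntegrable f volume 0 1) :
    ∃ u : ℝ → ℝ, Continuous u ∧ (∀ x ∈ Icc (0 : ℝ) 1, u x = sol β (fun t => f t - u t) x) ∧
      ∀ x, |u x| ≤ 2 * (1 + β) / β ^ 2 * ∫ s in (0 : ℝ)..1, |f s| := by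
  have hint : ∀ u : ℝ →ᵇ ℝ, IntervalIntegrable (fun t => f t - u t) volume 0 1 := fun u =>
    hf.sub (u.continuous.intervalIntegrable _ _)
  have hcl : ∀ x : ℝ, (projIcc (0 : ℝ) 1 zero_le_one x : ℝ) ∈ Icc (0 : ℝ) 1 := fun x =>
    (projIcc (0 : ℝ) 1 zero_le_one x).2
  have hbd : ∀ (u : ℝ →ᵇ ℝ) (x : ℝ), ‖sol β (fun t => f t - u t) (projIcc 0 1 zero_le_one x)‖
      ≤ (2 * ∫ s in (0 : ℝ)..1, |f s - u s|) * (1 / β) := by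
    intro u x
    refine (abs_sol_le hβ (hint u) (hcl x)).trans ?_
    have : 0 ≤ ∫ s in (0 : ℝ)..1, |f s - u s| :=
      intervalIntegral.integral_nonneg zero_le_one fun _ _ => abs_nonneg _
    gcongr
    exact Real.rpow_le_one (hcl x).1 (hcl x).2 hβ.le
  have hcont : ∀ u : ℝ →ᵇ ℝ,
      Continuous fun x => sol β (fun t => f t - u t) (projIcc (0 : ℝ) 1 zero_le_one x) := fun u =>
    (continuousOn_sol hβ (hint u)).comp_continuous (continuous_subtype_val.comp continuous_projIcc)
      hcl
  -- Composing with `projIcc` extends functions constantly beyond `[0, 1]`, so the contraction acts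
  -- on a complete space of functions on the line.
  let T : (ℝ →ᵇ ℝ) → (ℝ →ᵇ ℝ) := fun u =>
    BoundedContinuousFunction.ofNormedAddCommGroup _ (hcont u) _ (hbd u)
  have hT : ∀ u x, T u x = sol β (fun t => f t - u t) (projIcc (0 : ℝ) 1 zero_le_one x) :=
    fun u x => rfl
  have hlt : 1 / (1 + β) < 1 := by rw [div_lt_one] <;> linarith
  have hpos : 0 ≤ 1 / (1 + β) := by positivity
  have hcontr : ContractingWith ⟨1 / (1 + β), hpos⟩ T := by
    refine ⟨hlt, LipschitzWith.of_dist_le_mul fun u v => ?_⟩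
    rw [BoundedContinuousFunction.dist_le (by positivity)]
    intro x
    rw [hT, hT, dist_eq_norm, ← sol_sub hβ (hint u) (hint v) (hcl x)]
    refine abs_sol_le_of_bound hβ ((hint u).sub (hint v)) (fun t _ => ?_) (hcl x)
    rw [sub_sub_sub_cancel_left, ← Real.dist_eq, dist_comm]
    exact BoundedContinuousFunction.dist_coe_le_dist t
  set u := hcontr.fixedPoint T
  have hu : ∀ x, u x = sol β (fun t => f t - u t) (projIcc (0 : ℝ) 1 zero_le_one x) := fun x => by
    exact (congrArg (fun w : ℝ →ᵇ ℝ => w x) hcontr.fixedPoint_isFixedPt.eq).symm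
  refine ⟨u, u.continuous, fun x hx => ?_, fun x => ?_⟩
  · rw [hu x, projIcc_of_mem _ hx]
  · set N := ∫ s in (0 : ℝ)..1, |f s|
    have hN : 0 ≤ N := intervalIntegral.integral_nonneg zero_le_one fun _ _ => abs_nonneg _
    -- Linearity splits off `f`, which only needs its `L¹` norm; the contraction bound on the
    -- remaining term is absorbed into the left side.
    have h1 : ‖u‖ ≤ 2 * N * (1 / β) + 1 / (1 + β) * ‖u‖ := by
      rw [BoundedContinuousFunction.norm_le (by positivity)]
      intro y
      have hui := u.continuous.intervalIntegrable (μ := volume) 0 1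
      rw [hu y, sol_sub hβ hf hui (hcl y)]
      refine (abs_sub _ _).trans (add_le_add ((abs_sol_le hβ hf (hcl y)).trans ?_)
        (abs_sol_le_of_bound hβ hui (fun t _ => u.norm_coe_le_norm t) (hcl y)))
      gcongr
      exact Real.rpow_le_one (hcl y).1 (hcl y).2 hβ.le
    have h2 : ‖u‖ ≤ 2 * (1 + β) / β ^ 2 * N := by
      have h3 : ‖u‖ * (β / (1 + β)) ≤ 2 * N * (1 / β) := by
        have : β / (1 + β) = 1 - 1 / (1 + β) := by field_simp; ring
        rw [this]; linarith
      rw [← le_div_iff₀ (by positivity)] at h3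
      refine h3.trans (le_of_eq ?_)
      field_simp
    exact (u.norm_coe_le_norm x).trans h2

/-- Integration by parts of `(t^β)' W` with `W' = -g`; there is no boundary term at `0`. -/
theorem mul_sol_eq (hβ : 0 < β) (hg : IntervalIntegrable g volume 0 1) {x : ℝ}
    (hx : x ∈ Icc (0 : ℝ) 1) :
    β * sol β g x = x ^ β * flux β g x + ∫ t in (0 : ℝ)..x, t ^ β * g t := by
  have hwi : IntervalIntegrable (fun t : ℝ => β * t ^ (β - 1)) volume 0 x :=
    (intervalIntegrable_weight hβ 0 x).const_mul β
  have hgi := intervalIntegrable_of_zero_one hg (x := 0) (by simp) hx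
  -- Writing `t^β` as a primitive gives its absolute continuity up to `0`, where it is not
  -- differentiable for `β < 1`.
  have hpow : ∀ t : ℝ, ∫ s in (0 : ℝ)..t, β * s ^ (β - 1) = t ^ β := fun t => by
    rw [intervalIntegral.integral_const_mul, integral_weight hβ, Real.zero_rpow hβ.ne']
    field_simp
    simp
  have hA := hwi.absolutelyContinuousOnInterval_intervalIntegral (c := 0) (by simp)
  have hW : AbsolutelyContinuousOnInterval (flux β g) 0 x :=
    AbsolutelyContinuousOnInterval.fun_sub
      (contDiffOn_const.absolutelyContinuousOnInterval)
      (hgi.absolutelyContinuousOnInterval_intervalIntegral (c := 0) (by simp))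
  have key := hA.integral_deriv_mul_eq_sub hW
  simp only [hpow] at key
  have hci : IntervalIntegrable (fun t => β * (t ^ (β - 1) * flux β g t)) volume 0 x :=
    (intervalIntegrable_weight_mul hβ (continuousOn_flux hg) (by simp) hx).const_mul β
  have hci' : IntervalIntegrable (fun t => t ^ β * g t) volume 0 x :=
    hgi.continuousOn_mul (Real.continuous_rpow_const hβ.le).continuousOn
  have e : ∫ t in (0 : ℝ)..x, deriv (fun t : ℝ => t ^ β) t * flux β g t + t ^ β * deriv (flux β g) t
      = ∫ t in (0 : ℝ)..x, (β * (t ^ (β - 1) * flux β g t) - t ^ β * g t) := by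
    apply intervalIntegral.integral_congr_ae
    filter_upwards [hgi.ae_hasDerivAt_integral] with t ht htm
    have h1 : HasDerivAt (flux β g) (-g t) t :=
      (ht (uIoc_subset_uIcc htm) 0 (by simp)).const_sub _
    rw [uIoc_of_le hx.1] at htm
    rw [h1.deriv, (Real.hasDerivAt_rpow_const (.inl htm.1.ne')).deriv]
    ring
  rw [e, intervalIntegral.integral_sub hci hci', intervalIntegral.integral_const_mul,
    Real.zero_rpow hβ.ne', zero_mul, sub_zero] at key
  rw [sol]
  linarith

end SingularSL

/-! ### Hardy's inequality by a Schur test. -/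

namespace SingularSL

variable {β : ℝ}

theorem lintegral_hardyKernel_left_le (hβ : 0 < β) {x : ℝ} (hx : 0 < x) :
    ∫⁻ t in Ioc 0 x, ENNReal.ofReal (x ^ (-β - 1) * t ^ β) ≤ 1 := by
  have hi : IntervalIntegrable (fun t : ℝ => x ^ (-β - 1) * t ^ β) volume 0 x :=
    (intervalIntegral.intervalIntegrable_rpow' (by linarith)).const_mul _
  rw [← ofReal_integral_eq_lintegral_ofReal ((intervalIntegrable_iff_integrableOn_Ioc_of_le hx.le).1 hi)
    ((ae_restrict_mem measurableSet_Ioc).mono fun t ht =>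
      mul_nonneg (Real.rpow_nonneg hx.le _) (Real.rpow_nonneg ht.1.le _)),
    ← intervalIntegral.integral_of_le hx.le, intervalIntegral.integral_const_mul,
    integral_rpow (.inl (by linarith)), Real.zero_rpow (by linarith), sub_zero, ← mul_div_assoc,
    ← Real.rpow_add hx]
  rw [ENNReal.ofReal_le_one]
  have : -β - 1 + (β + 1) = 0 := by ring
  rw [this, Real.rpow_zero, div_le_one] <;> linarith

theorem lintegral_hardyKernel_right_le (hβ : 0 < β) {t : ℝ} (ht : 0 < t) (ht1 : t ≤ 1) :
    ∫⁻ x in Ioc t 1, ENNReal.ofReal (x ^ (-β - 1) * t ^ β) ≤ ENNReal.ofReal (1 / β) := by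
  have h0 : (0 : ℝ) ∉ uIcc t 1 := by
    rw [uIcc_of_le ht1]; exact fun h => absurd h.1 (not_le.2 ht)
  have hi : IntervalIntegrable (fun x : ℝ => x ^ (-β - 1) * t ^ β) volume t 1 :=
    (intervalIntegral.intervalIntegrable_rpow (.inr h0)).mul_const _
  rw [← ofReal_integral_eq_lintegral_ofReal ((intervalIntegrable_iff_integrableOn_Ioc_of_le ht1).1 hi)
    ((ae_restrict_mem measurableSet_Ioc).mono fun x hx =>
      mul_nonneg (Real.rpow_nonneg (ht.trans hx.1).le _) (Real.rpow_nonneg ht.le _)),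
    ← intervalIntegral.integral_of_le ht1, intervalIntegral.integral_mul_const,
    integral_rpow (.inr ⟨by linarith, h0⟩), Real.one_rpow]
  apply ENNReal.ofReal_le_ofReal
  rw [show -β - 1 + 1 = -β by ring, show (1 - t ^ (-β)) / (-β) * t ^ β
    = (t ^ (-β) * t ^ β - t ^ β) / β by field_simp; ring, ← Real.rpow_add ht]
  simp only [neg_add_cancel, Real.rpow_zero]
  gcongr
  linarith [Real.rpow_nonneg ht.le β]

/-- Jensen's inequality: the kernel `x^{-β-1} t^β` on `(0, x]` has total mass at most one in `t`. -/
theorem rpow_lintegral_hardyKernel_le (hβ : 0 < β) {r : ℝ} (hr : 1 ≤ r) {G : ℝ → ℝ≥0∞}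
    (hG : Measurable G) {x : ℝ} (hx : 0 < x) :
    (∫⁻ t in Ioc 0 x, ENNReal.ofReal (x ^ (-β - 1) * t ^ β) * G t) ^ r
      ≤ ∫⁻ t in Ioc 0 x, ENNReal.ofReal (x ^ (-β - 1) * t ^ β) * G t ^ r := by
  have hk : Measurable fun t : ℝ => ENNReal.ofReal (x ^ (-β - 1) * t ^ β) := by fun_prop
  set μ := (volume.restrict (Ioc 0 x)).withDensity fun t => ENNReal.ofReal (x ^ (-β - 1) * t ^ β)
    with hμ
  have h1 : μ univ ≤ 1 := by
    rw [hμ, withDensity_apply _ .univ, Measure.restrict_univ]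
    exact lintegral_hardyKernel_left_le hβ hx
  have h2 := eLpNorm'_le_eLpNorm'_mul_rpow_measure_univ (μ := μ) (f := G) zero_lt_one hr
    hG.aestronglyMeasurable
  have h3 : eLpNorm' G 1 μ ≤ eLpNorm' G r μ := by
    refine h2.trans (mul_le_of_le_one_right' (ENNReal.rpow_le_one h1 ?_))
    rw [sub_nonneg]
    exact one_div_le_one_div_of_le one_pos hr
  have hr0 : 0 < r := one_pos.trans_le hr
  simp only [eLpNorm', ENNReal.rpow_one, div_one, enorm_eq_self] at h3
  rw [one_div, ENNReal.le_rpow_inv_iff hr0] at h3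
  rwa [hμ, lintegral_withDensity_eq_lintegral_mul _ hk hG,
    lintegral_withDensity_eq_lintegral_mul _ hk (hG.pow_const r)] at h3

/-- Tonelli, after which the inner integral of the kernel in `x` over `(t, 1)` is at most `1 / β`.
-/
theorem lintegral_hardy_le (hβ : 0 < β) {G : ℝ → ℝ≥0∞} (hG : Measurable G) :
    ∫⁻ x in Ioo 0 1, ∫⁻ t in Ioc 0 x, ENNReal.ofReal (x ^ (-β - 1) * t ^ β) * G t
      ≤ ENNReal.ofReal (1 / β) * ∫⁻ t in Ioo 0 1, G t := by
  set F : ℝ → ℝ → ℝ≥0∞ := fun x t =>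
    {q : ℝ × ℝ | 0 < q.2 ∧ q.2 ≤ q.1}.indicator
      (fun q => ENNReal.ofReal (q.1 ^ (-β - 1) * q.2 ^ β) * G q.2) (x, t) with hF
  have hFm : Measurable (Function.uncurry F) := by
    have hs : MeasurableSet {q : ℝ × ℝ | 0 < q.2 ∧ q.2 ≤ q.1} :=
      (measurableSet_lt measurable_const measurable_snd).inter
        (measurableSet_le measurable_snd measurable_fst)
    have : Measurable fun q : ℝ × ℝ => ENNReal.ofReal (q.1 ^ (-β - 1) * q.2 ^ β) * G q.2 := by
      fun_prop
    exact this.indicator hs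
  have h1 : ∀ x ∈ Ioo (0 : ℝ) 1,
      ∫⁻ t in Ioc 0 x, ENNReal.ofReal (x ^ (-β - 1) * t ^ β) * G t = ∫⁻ t in Ioo 0 1, F x t := by
    intro x hx
    have : ∀ t, F x t
        = (Ioc 0 x).indicator (fun t => ENNReal.ofReal (x ^ (-β - 1) * t ^ β) * G t) t :=
      fun t => rfl
    simp only [this]
    rw [lintegral_indicator measurableSet_Ioc, Measure.restrict_restrict measurableSet_Ioc,
      inter_eq_left.2 (Ioc_subset_Ioo_right hx.2)]
  have h2 : ∀ t ∈ Ioo (0 : ℝ) 1, ∫⁻ x in Ioo 0 1, F x t ≤ ENNReal.ofReal (1 / β) * G t := by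
    intro t ht
    have hle : ∫⁻ x in Ioo 0 1, F x t
        ≤ ∫⁻ x in Ioc 0 1, (Ici t).indicator
          (fun x => ENNReal.ofReal (x ^ (-β - 1) * t ^ β) * G t) x := by
      refine (lintegral_mono_set Ioo_subset_Ioc_self).trans (lintegral_mono fun x => ?_)
      simp only [hF, indicator, mem_ofPred_eq, mem_Ici]
      split_ifs <;> simp_all
    refine hle.trans ?_
    rw [lintegral_indicator measurableSet_Ici, Measure.restrict_restrict measurableSet_Ici,
      show Ici t ∩ Ioc 0 1 = Icc t 1 by
        ext x; exact ⟨fun h => ⟨h.1, h.2.2⟩, fun h => ⟨h.1, ht.1.trans_le h.1, h.2⟩⟩,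
      lintegral_mul_const _ (by fun_prop), ← restrict_Ioc_eq_restrict_Icc]
    gcongr
    exact lintegral_hardyKernel_right_le hβ ht.1 ht.2.le
  rw [setLIntegral_congr_fun measurableSet_Ioo h1, lintegral_lintegral_swap hFm.aemeasurable,
    ← lintegral_const_mul _ hG]
  exact setLIntegral_mono' measurableSet_Ioo h2

theorem enorm_hardy_le {g : ℝ → ℝ} {x : ℝ} (hx : 0 < x) :
    ‖x ^ (-β - 1) * ∫ t in (0 : ℝ)..x, t ^ β * g t‖ₑ
      ≤ ∫⁻ t in Ioc 0 x, ENNReal.ofReal (x ^ (-β - 1) * t ^ β) * ‖g t‖ₑ := by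
  rw [← intervalIntegral.integral_const_mul, intervalIntegral.integral_of_le hx.le]
  refine (enorm_integral_le_lintegral_enorm _).trans (le_of_eq ?_)
  refine setLIntegral_congr_fun measurableSet_Ioc fun t ht => ?_
  rw [← mul_assoc, enorm_mul, Real.enorm_eq_ofReal
    (mul_nonneg (Real.rpow_nonneg hx.le _) (Real.rpow_nonneg ht.1.le _))]

/-- **Hardy's inequality** for the averaging operator with weight `t ^ β` on `(0, 1)`. -/
theorem eLpNorm_hardy_le (hβ : 0 < β) {p : ℝ≥0∞} (hp : 1 ≤ p) {g : ℝ → ℝ}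
    (hg : AEStronglyMeasurable g (vol 0 1)) :
    eLpNorm (fun x => x ^ (-β - 1) * ∫ t in (0 : ℝ)..x, t ^ β * g t) p (vol 0 1)
      ≤ ENNReal.ofReal (1 + 1 / β) * eLpNorm g p (vol 0 1) := by
  -- The averages depend only on the a.e. class of `g`, so a measurable representative may be used
  -- in Tonelli's theorem.
  wlog hgm : StronglyMeasurable g generalizing g
  · have h := this hg.stronglyMeasurable_mk.aestronglyMeasurable hg.stronglyMeasurable_mk
    rw [eLpNorm_congr_ae hg.ae_eq_mk]
    refine le_of_eq_of_le (eLpNorm_congr_ae ?_) h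
    filter_upwards [ae_restrict_mem measurableSet_Ioo] with x hx
    congr 1
    apply intervalIntegral.integral_congr_ae
    have h2 := hg.ae_eq_mk
    rw [EventuallyEq, ae_restrict_iff' measurableSet_Ioo] at h2
    filter_upwards [h2] with t ht htm
    rw [uIoc_of_le hx.1.le] at htm
    rw [← ht ⟨htm.1, htm.2.trans_lt hx.2⟩]
  have hC : 1 ≤ ENNReal.ofReal (1 + 1 / β) := by
    rw [ENNReal.one_le_ofReal]
    have : 0 < 1 / β := by positivity
    linarith
  rcases eq_or_ne p ∞ with rfl | hpt
  · rw [eLpNorm_exponent_top, eLpNorm_exponent_top]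
    refine le_trans ?_ (le_mul_of_one_le_left' hC)
    refine essSup_le_of_ae_le _ ?_
    have h1 : ∀ᵐ t ∂(vol 0 1), ‖g t‖ₑ ≤ eLpNormEssSup g (vol 0 1) := ae_le_eLpNormEssSup
    filter_upwards [ae_restrict_mem measurableSet_Ioo] with x hx
    refine (enorm_hardy_le hx.1).trans ?_
    have h2 : ∫⁻ t in Ioc 0 x, ENNReal.ofReal (x ^ (-β - 1) * t ^ β) * ‖g t‖ₑ
        ≤ ∫⁻ t in Ioc 0 x, ENNReal.ofReal (x ^ (-β - 1) * t ^ β) * eLpNormEssSup g (vol 0 1) := by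
      apply lintegral_mono_ae
      filter_upwards [ae_restrict_of_ae_restrict_of_subset
        (Ioc_subset_Ioo_right hx.2) h1] with t ht
      gcongr
    refine h2.trans ?_
    rw [lintegral_mul_const _ (by fun_prop)]
    exact mul_le_of_le_one_left' (lintegral_hardyKernel_left_le hβ hx.1)
  · have hp0 : p ≠ 0 := (one_pos.trans_le hp).ne'
    have hr : 1 ≤ p.toReal := by
      rw [← ENNReal.toReal_one]; exact ENNReal.toReal_mono hpt hp
    have hr0 : 0 < p.toReal := one_pos.trans_le hr
    rw [eLpNorm_eq_lintegral_rpow_enorm_toReal hp0 hpt,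
      eLpNorm_eq_lintegral_rpow_enorm_toReal hp0 hpt]
    -- Jensen pointwise in `x`, then the `L¹` estimate for `|g|^p`.
    have h1 : ∫⁻ x in Ioo 0 1, ‖x ^ (-β - 1) * ∫ t in (0 : ℝ)..x, t ^ β * g t‖ₑ ^ p.toReal
        ≤ ENNReal.ofReal (1 / β) * ∫⁻ t in Ioo 0 1, ‖g t‖ₑ ^ p.toReal := by
      refine le_trans ?_ (lintegral_hardy_le hβ (hgm.measurable.enorm.pow_const _))
      refine setLIntegral_mono' measurableSet_Ioo fun x hx => ?_
      exact (ENNReal.rpow_le_rpow (enorm_hardy_le hx.1) hr0.le).trans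
        (rpow_lintegral_hardyKernel_le hβ hr hgm.measurable.enorm hx.1)
    refine (ENNReal.rpow_le_rpow h1 (by positivity)).trans ?_
    rw [ENNReal.mul_rpow_of_nonneg _ _ (by positivity)]
    gcongr
    -- The constant obtained is `(1 / β)^{1/p}`; enlarging the base to at least one removes the
    -- dependence on `p`.
    calc ENNReal.ofReal (1 / β) ^ (1 / p.toReal)
        ≤ ENNReal.ofReal (1 + 1 / β) ^ (1 / p.toReal) := by gcongr; linarith
      _ ≤ ENNReal.ofReal (1 + 1 / β) ^ (1 : ℝ) :=
          ENNReal.rpow_le_rpow_of_exponent_le hC (by rw [div_le_one hr0]; exact hr)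
      _ = _ := ENNReal.rpow_one _

end SingularSL

/-! ### Norm bounds and weak derivatives of the explicit solution. -/

namespace SingularSL

theorem IsWeakDeriv.add_const_mul {a b : ℝ} {u v u' v' : ℝ → ℝ} (h : IsWeakDeriv 1 a b u v)
    (h' : IsWeakDeriv 1 a b u' v') (r : ℝ) :
    IsWeakDeriv 1 a b (fun x => u x + r * u' x) (fun x => v x + r * v' x) := by
  have hs : IsWeakDeriv 1 a b (fun x => (-r) * u' x) (fun x => (-r) * v' x) := by
    refine ⟨h'.left.smul (-r), h'.right.smul (-r), fun φ h1 h2 h3 => ?_⟩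
    have e := h'.eq φ h1 h2 h3
    simp only [mul_assoc, integral_const_mul]
    rw [e]
    ring
  exact (h.sub hs).congr_on (fun x _ => by ring) (fun x _ => by ring)

theorem memLp_of_eLpNorm_le {a b : ℝ} {p : ℝ≥0∞} {h : ℝ → ℝ}
    (hl : LocallyIntegrableOn h (Ioo a b) volume) {A : ℝ}
    (hA : eLpNorm h p (vol a b) ≤ ENNReal.ofReal A) : MemLp h p (vol a b) :=
  ⟨hl.aestronglyMeasurable, hA.trans_lt ENNReal.ofReal_lt_top⟩

theorem eLpNorm_le_of_bound {p : ℝ≥0∞} {h : ℝ → ℝ} {A : ℝ} (hA : ∀ x ∈ Ioo (0 : ℝ) 1, |h x| ≤ A) :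
    eLpNorm h p (vol 0 1) ≤ ENNReal.ofReal A := by
  refine (eLpNorm_le_of_ae_bound (C := A) ?_).trans (by simp)
  exact (ae_restrict_mem measurableSet_Ioo).mono hA

theorem eLpNorm_add_const_mul_le {a b : ℝ} {p : ℝ≥0∞} (hp : 1 ≤ p) {h k : ℝ → ℝ} {A B : ℝ}
    (hA0 : 0 ≤ A) (hB0 : 0 ≤ B)
    (hh : MemLp h p (vol a b)) (hk : MemLp k p (vol a b))
    (hA : eLpNorm h p (vol a b) ≤ ENNReal.ofReal A) (hB : eLpNorm k p (vol a b) ≤ ENNReal.ofReal B)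
    (r : ℝ) : eLpNorm (fun x => h x + r * k x) p (vol a b) ≤ ENNReal.ofReal (A + |r| * B) := by
  refine (eLpNorm_add_le hh.1 (hk.1.const_mul r) hp).trans ?_
  rw [ENNReal.ofReal_add hA0 (by positivity), ENNReal.ofReal_mul (abs_nonneg r)]
  gcongr
  refine (eLpNorm_const_smul_le (c := r) (f := k)).trans ?_
  rw [← Real.norm_eq_abs, ofReal_norm]
  gcongr

theorem memSobolev_one {a b : ℝ} {p : ℝ≥0∞} {U V : ℝ → ℝ} (h : IsWeakDeriv 1 a b U V)
    (hU : MemLp U p (vol a b)) (hV : MemLp V p (vol a b)) : MemSobolev 1 p a b U := by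
  intro j hj
  interval_cases j
  · exact ⟨U, .refl h.left, hU⟩
  · exact ⟨V, h, hV⟩

theorem memSobolev_two {a b : ℝ} {p : ℝ≥0∞} {U V Z : ℝ → ℝ} (h : IsWeakDeriv 1 a b U V)
    (h' : IsWeakDeriv 1 a b V Z) (hU : MemLp U p (vol a b)) (hV : MemLp V p (vol a b))
    (hZ : MemLp Z p (vol a b)) : MemSobolev 2 p a b U := by
  intro j hj
  interval_cases j
  · exact ⟨U, .refl h.left, hU⟩
  · exact ⟨V, h, hV⟩
  · exact ⟨Z, h.trans h', hZ⟩

theorem sobolevNorm_one_le {a b : ℝ} {p : ℝ≥0∞} {U V : ℝ → ℝ} (h : IsWeakDeriv 1 a b U V) :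
    sobolevNorm 1 p a b U ≤ eLpNorm U p (vol a b) + eLpNorm V p (vol a b) := by
  rw [sobolevNorm, Finset.sum_range_succ, Finset.sum_range_one]
  exact add_le_add (iInf₂_le U (.refl h.left)) (iInf₂_le V h)

theorem sobolevNorm_two_le {a b : ℝ} {p : ℝ≥0∞} {U V Z : ℝ → ℝ} (h : IsWeakDeriv 1 a b U V)
    (h' : IsWeakDeriv 1 a b V Z) :
    sobolevNorm 2 p a b U
      ≤ eLpNorm U p (vol a b) + eLpNorm V p (vol a b) + eLpNorm Z p (vol a b) := by
  rw [sobolevNorm, Finset.sum_range_succ, Finset.sum_range_succ, Finset.sum_range_one]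
  exact add_le_add (add_le_add (iInf₂_le U (.refl h.left)) (iInf₂_le V h))
    (iInf₂_le Z (h.trans h'))

theorem MemSobolev.congr_on {k : ℕ} {a b : ℝ} {p : ℝ≥0∞} {U V : ℝ → ℝ} (h : MemSobolev k p a b U)
    (e : EqOn U V (Ioo a b)) : MemSobolev k p a b V := fun j hj =>
  let ⟨v, hv, hm⟩ := h j hj
  ⟨v, hv.congr_on e fun _ _ => rfl, hm⟩

theorem sobolevNorm_le_of_eqOn {k : ℕ} {a b : ℝ} {p : ℝ≥0∞} {U V : ℝ → ℝ}
    (e : EqOn U V (Ioo a b)) : sobolevNorm k p a b V ≤ sobolevNorm k p a b U :=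
  Finset.sum_le_sum fun _ _ => le_iInf₂ fun v hv =>
    iInf₂_le v (hv.congr_on e fun _ _ => rfl)

theorem memLp_rpow_mul {p : ℝ≥0∞} {h : ℝ → ℝ} (hh : MemLp h p (vol 0 1)) {ε : ℝ} (hε : 0 < ε)
    (s : ℝ) : MemLp (fun x => x ^ s * h x) p (vol ε 1) := by
  have hle : vol ε 1 ≤ vol 0 1 := Measure.restrict_mono_set _ (Ioo_subset_Ioo_left hε.le)
  have hh' := hh.mono_measure hle
  obtain ⟨M, hM⟩ := isCompact_Icc.exists_bound_of_continuousOn (s := Icc ε 1)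
    (f := fun x : ℝ => x ^ s) fun x hx =>
      (Real.continuousAt_rpow_const x s (.inl (hε.trans_le hx.1).ne')).continuousWithinAt
  refine hh'.of_le_mul (c := M) ((by fun_prop : Measurable fun x : ℝ => x ^ s)
    |>.aestronglyMeasurable.mul hh'.1) ?_
  filter_upwards [ae_restrict_mem measurableSet_Ioo] with x hx
  rw [norm_mul]
  exact mul_le_mul_of_nonneg_right (hM x (Ioo_subset_Icc_self hx)) (norm_nonneg _)

theorem holderNorm_le {γ : ℝ} {u : ℝ → ℝ} {A B : ℝ} (hB : 0 ≤ B)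
    (hA : ∀ x ∈ Icc (0 : ℝ) 1, |u x| ≤ A)
    (h : ∀ x y, 0 ≤ x → x < y → y ≤ 1 → |u y - u x| ≤ B * (y - x) ^ γ) :
    holderNorm γ u ≤ ENNReal.ofReal A + ENNReal.ofReal B := by
  have key : ∀ x y, 0 ≤ x → x < y → y ≤ 1 →
      edist (u x) (u y) / edist x y ^ γ ≤ ENNReal.ofReal B := by
    intro x y hx hxy hy
    have h1 := h x y hx hxy hy
    refine ENNReal.div_le_of_le_mul ?_
    rw [edist_comm, edist_comm x y, edist_dist, edist_dist, Real.dist_eq, Real.dist_eq,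
      abs_of_pos (sub_pos.2 hxy), ENNReal.ofReal_rpow_of_pos (sub_pos.2 hxy),
      ← ENNReal.ofReal_mul hB]
    exact ENNReal.ofReal_le_ofReal h1
  refine add_le_add (iSup₂_le fun x hx => ?_)
    (iSup₂_le fun x hx => iSup₂_le fun y hy => iSup_le fun hne => ?_)
  · rw [Real.enorm_eq_ofReal_abs]
    exact ENNReal.ofReal_le_ofReal (hA x hx)
  · rcases hne.lt_or_gt with hlt | hlt
    · exact key x y hx.1 hlt hy.2
    · rw [edist_comm, edist_comm x y]
      exact key y x hy.1 hlt hx.2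

/-- Subadditivity of `t^β` gives the exponent `β`; halving it only enlarges the right side, since `y
- x ≤ 1`. -/
theorem rpow_sub_rpow_le_of_le_one {β : ℝ} (hβ : 0 < β) (hβ1 : β ≤ 1) {x y : ℝ} (hx : 0 ≤ x)
    (hxy : x < y) (hy : y ≤ 1) : y ^ β - x ^ β ≤ (y - x) ^ (β / 2) := by
  have h1 := Real.rpow_add_le_add_rpow hx (sub_nonneg.2 hxy.le) hβ.le hβ1
  rw [add_sub_cancel] at h1
  have h2 : (y - x) ^ β ≤ (y - x) ^ (β / 2) :=
    Real.rpow_le_rpow_of_exponent_ge (sub_pos.2 hxy) (by linarith) (by linarith)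
  linarith

/-- Bernoulli's inequality for `(x / y)^β` yields the Lipschitz bound `β (y - x)`, weakened to
exponent `1/2`. -/
theorem rpow_sub_rpow_le_of_one_le {β : ℝ} (hβ : 1 ≤ β) {x y : ℝ} (hx : 0 ≤ x)
    (hxy : x < y) (hy : y ≤ 1) : y ^ β - x ^ β ≤ β * (y - x) ^ (1 / 2 : ℝ) := by
  have hy0 : 0 < y := hx.trans_lt hxy
  have h1 := one_add_mul_self_le_rpow_one_add (s := x / y - 1) (by
    have := div_nonneg hx hy0.le; linarith) hβ
  rw [add_sub_cancel, Real.div_rpow hx hy0.le, le_div_iff₀ (Real.rpow_pos_of_pos hy0 β)] at h1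
  have h2 : y ^ β ≤ y := by
    simpa using Real.rpow_le_rpow_of_exponent_ge hy0 hy hβ
  have h3 : (x / y - 1) * y ^ β = - ((y - x) * (y ^ β / y)) := by field_simp; ring
  have h4 : y ^ β / y ≤ 1 := (div_le_one hy0).2 h2
  have h5 : (y - x) * (y ^ β / y) ≤ y - x := mul_le_of_le_one_right (by linarith) h4
  have h6 : y - x ≤ (y - x) ^ (1 / 2 : ℝ) := by
    simpa using Real.rpow_le_rpow_of_exponent_ge (sub_pos.2 hxy) (by linarith)
      (by norm_num : (1 / 2 : ℝ) ≤ 1)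
  have h7 : β * ((y - x) * (y ^ β / y)) ≤ β * (y - x) ^ (1 / 2 : ℝ) :=
    mul_le_mul_of_nonneg_left (h5.trans h6) (by linarith)
  have h8 : (1 + β * (x / y - 1)) * y ^ β = y ^ β - β * ((y - x) * (y ^ β / y)) := by
    rw [add_mul, mul_assoc, h3]; ring
  linarith

theorem intervalIntegrable_of_memLp {p : ℝ≥0∞} (hp : 1 ≤ p) {g : ℝ → ℝ}
    (hg : MemLp g p (vol 0 1)) : IntervalIntegrable g volume 0 1 :=
  (intervalIntegrable_iff_integrableOn_Ioo_of_le zero_le_one).2 (hg.integrable hp)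

theorem integral_abs_le_eLpNorm {p : ℝ≥0∞} (hp : 1 ≤ p) {g : ℝ → ℝ}
    (hg : MemLp g p (vol 0 1)) :
    ∫ s in (0 : ℝ)..1, |g s| ≤ (eLpNorm g p (vol 0 1)).toReal := by
  rw [intervalIntegral.integral_of_le zero_le_one, integral_Ioc_eq_integral_Ioo]
  have h1 : ∫ s in Ioo (0 : ℝ) 1, |g s| = (eLpNorm g 1 (vol 0 1)).toReal := by
    rw [eLpNorm_one_eq_lintegral_enorm, ← integral_norm_eq_lintegral_enorm hg.1]
    rfl
  rw [h1]
  exact ENNReal.toReal_mono hg.2.ne (eLpNorm_le_eLpNorm_of_exponent_le hp hg.1)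

section Linear

variable {β : ℝ} {g : ℝ → ℝ}

theorem isWeakDeriv_flux (hg : IntervalIntegrable g volume 0 1) :
    IsWeakDeriv 1 0 1 (flux β g) (fun x => -g x) := by
  have hhalf : (1 / 2 : ℝ) ∈ Ioo (0 : ℝ) 1 := by norm_num
  have hi : IntegrableOn g (Ioo 0 1) volume :=
    (intervalIntegrable_iff_integrableOn_Ioo_of_le zero_le_one).1 hg
  refine isWeakDeriv_of_primitive (K := flux β g (1 / 2)) hhalf hi.neg.locallyIntegrableOn
    fun x hx => ?_
  have := intervalIntegral.integral_add_adjacent_intervals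
    (intervalIntegrable_of_zero_one hg (x := 0) (y := 1 / 2) (by simp) (by norm_num))
    (intervalIntegrable_of_zero_one hg (x := 1 / 2) (by norm_num) (Ioo_subset_Icc_self hx))
  rw [intervalIntegral.integral_neg, flux, flux, ← this]
  ring

theorem isWeakDeriv_sol (hβ : 0 < β) (hg : IntervalIntegrable g volume 0 1) :
    IsWeakDeriv 1 0 1 (sol β g) (fun x => x ^ (β - 1) * flux β g x) := by
  have hhalf : (1 / 2 : ℝ) ∈ Ioo (0 : ℝ) 1 := by norm_num
  have hi := (intervalIntegrable_iff_integrableOn_Ioo_of_le zero_le_one).1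
    (intervalIntegrable_weight_mul hβ (continuousOn_flux (β := β) hg)
      (x := 0) (y := 1) (by simp) (by simp))
  refine isWeakDeriv_of_primitive (K := sol β g (1 / 2)) hhalf hi.locallyIntegrableOn fun x hx => ?_
  rw [← sol_sub_sol hβ hg (Ioo_subset_Icc_self hhalf) (Ioo_subset_Icc_self hx)]
  ring

/-- The product rule gives `x^{-β-1} (x^β W - β u)`, and `mul_sol_eq` turns the bracket into a Hardy
average of `g`. -/
theorem isWeakDeriv_rpow_mul_sol (hβ : 0 < β) (hg : IntervalIntegrable g volume 0 1) :
    IsWeakDeriv 1 0 1 (fun x => x ^ (-β) * sol β g x)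
      (fun x => -(x ^ (-β - 1) * ∫ t in (0 : ℝ)..x, t ^ β * g t)) := by
  refine ((isWeakDeriv_sol hβ hg).rpow_mul le_rfl (-β)).congr_on (fun _ _ => rfl) fun x hx => ?_
  have h1 := mul_sol_eq hβ hg (Ioo_subset_Icc_self hx)
  have h2 : x ^ (-β) * (x ^ (β - 1) * flux β g x) = x ^ (-β - 1) * (x ^ β * flux β g x) := by
    rw [← mul_assoc, ← mul_assoc, ← Real.rpow_add hx.1, ← Real.rpow_add hx.1]
    congr 2; ring
  simp only
  rw [h2, eq_sub_of_add_eq h1.symm]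
  ring

theorem isWeakDeriv_rpow_one_sub_mul_sol (hβ : 0 < β) (hg : IntervalIntegrable g volume 0 1) :
    IsWeakDeriv 1 0 1 (fun x => x ^ (1 - β) * sol β g x)
      (fun x => flux β g x + (1 - β) * (x ^ (-β) * sol β g x)) := by
  refine ((isWeakDeriv_sol hβ hg).rpow_mul le_rfl (1 - β)).congr_on (fun _ _ => rfl) fun x hx => ?_
  have h2 : x ^ (1 - β) * (x ^ (β - 1) * flux β g x) = flux β g x := by
    rw [← mul_assoc, ← Real.rpow_add hx.1]; simp
  simp only
  rw [h2, show 1 - β - 1 = -β by ring]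
  ring

theorem abs_rpow_mul_sol_le (hβ : 0 < β) (hg : IntervalIntegrable g volume 0 1) {x : ℝ}
    (hx : x ∈ Ioc (0 : ℝ) 1) :
    |x ^ (-β) * sol β g x| ≤ 2 * (1 / β) * ∫ s in (0 : ℝ)..1, |g s| := by
  have h1 := abs_sol_le hβ hg (Ioc_subset_Icc_self hx)
  rw [abs_mul, abs_of_pos (Real.rpow_pos_of_pos hx.1 _)]
  refine (mul_le_mul_of_nonneg_left h1 (Real.rpow_nonneg hx.1.le _)).trans (le_of_eq ?_)
  have : x ^ (-β) * x ^ β = 1 := by rw [← Real.rpow_add hx.1]; simp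
  calc _ = 2 * (1 / β) * (∫ s in (0 : ℝ)..1, |g s|) * (x ^ (-β) * x ^ β) := by ring
    _ = _ := by rw [this, mul_one]

theorem abs_sol_le_const (hβ : 0 < β) (hg : IntervalIntegrable g volume 0 1) {x : ℝ}
    (hx : x ∈ Icc (0 : ℝ) 1) : |sol β g x| ≤ 2 * (1 / β) * ∫ s in (0 : ℝ)..1, |g s| := by
  refine (abs_sol_le hβ hg hx).trans ?_
  have : 0 ≤ ∫ s in (0 : ℝ)..1, |g s| :=
    intervalIntegral.integral_nonneg zero_le_one fun _ _ => abs_nonneg _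
  have h2 : x ^ β / β ≤ 1 / β := by
    gcongr; exact Real.rpow_le_one hx.1 hx.2 hβ.le
  calc _ ≤ (2 * ∫ s in (0 : ℝ)..1, |g s|) * (1 / β) := by gcongr
    _ = _ := by ring

end Linear

end SingularSL

/-! ### All estimates for the linear problem. -/

namespace SingularSL

theorem memSobolevLoc_sol {β : ℝ} (hβ : 0 < β) {p : ℝ≥0∞} (hp : 1 ≤ p) {g : ℝ → ℝ}
    (hgp : MemLp g p (vol 0 1)) (hu : MemLp (sol β g) p (vol 0 1))
    (hW : MemLp (flux β g) p (vol 0 1)) : MemSobolevLoc 2 p (sol β g) := by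
  intro ε hε
  have hg := intervalIntegrable_of_memLp hp hgp
  have hsub : Ioo ε 1 ⊆ Ioo 0 1 := Ioo_subset_Ioo_left hε.1.le
  refine memSobolev_two ((isWeakDeriv_sol hβ hg).mono hsub)
    (((isWeakDeriv_flux hg).rpow_mul le_rfl (β - 1)).mono hsub)
    (hu.mono_measure (Measure.restrict_mono_set _ hsub)) (memLp_rpow_mul hW hε.1 _) ?_
  have := (memLp_rpow_mul hW hε.1 (β - 1 - 1)).const_mul (β - 1)
  simp only [← mul_assoc] at this
  exact (memLp_rpow_mul hgp.neg hε.1 (β - 1)).add this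

/-- The estimates for `sol β g` in terms of a common bound `E` of the `L^1` and `L^p` norms of the
right hand side. -/
theorem sol_estimates {β : ℝ} (hβ : 0 < β) {p : ℝ≥0∞} (hp : 1 ≤ p) {g : ℝ → ℝ} {E : ℝ}
    (hgp : MemLp g p (vol 0 1)) (hE1 : ∫ s in (0 : ℝ)..1, |g s| ≤ E)
    (hEp : eLpNorm g p (vol 0 1) ≤ ENNReal.ofReal E) :
    MemSobolevLoc 2 p (sol β g) ∧
    (MemLp (sol β g) p (vol 0 1) ∧
      eLpNorm (sol β g) p (vol 0 1) ≤ ENNReal.ofReal (2 * (1 / β) * E)) ∧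
    (MemSobolev 1 p 0 1 (flux β g) ∧ MemSobolev 1 p 0 1 (fun x => x ^ (-β) * sol β g x) ∧
      sobolevNorm 1 p 0 1 (flux β g) + sobolevNorm 1 p 0 1 (fun x => x ^ (-β) * sol β g x)
        ≤ ENNReal.ofReal ((4 + 3 * (1 / β)) * E)) ∧
    (MemSobolev 2 p 0 1 (fun x => x ^ (1 - β) * sol β g x) ∧
      sobolevNorm 2 p 0 1 (fun x => x ^ (1 - β) * sol β g x)
        ≤ ENNReal.ofReal ((3 + 2 * (1 / β) + |1 - β| * (1 + 3 * (1 / β))) * E)) ∧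
    (∀ γ : ℝ, (∀ x y : ℝ, 0 ≤ x → x < y → y ≤ 1 → y ^ β - x ^ β ≤ (1 + β) * (y - x) ^ γ) →
      holderNorm γ (sol β g) ≤ ENNReal.ofReal ((2 + 4 * (1 / β)) * E)) ∧
    ∀ x ∈ Ioc (0 : ℝ) 1, |x ^ (-β) * sol β g x| ≤ 2 * (1 / β) * E := by
  have hg := intervalIntegrable_of_memLp hp hgp
  have hN : 0 ≤ ∫ s in (0 : ℝ)..1, |g s| :=
    intervalIntegral.integral_nonneg zero_le_one fun _ _ => abs_nonneg _
  have hE0 : 0 ≤ E := hN.trans hE1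
  set q := 1 / β with hq
  have hq0 : 0 < q := by positivity
  have hqE : 2 * q * ∫ s in (0 : ℝ)..1, |g s| ≤ 2 * q * E := by gcongr
  have dW := isWeakDeriv_flux (β := β) hg
  have du := isWeakDeriv_sol hβ hg
  have dv := isWeakDeriv_rpow_mul_sol hβ hg
  have dx := isWeakDeriv_rpow_one_sub_mul_sol hβ hg
  -- The first derivative of `x^{1-β} u` is `W + (1-β) x^{-β} u`, so its second derivative involves
  -- only `g` and the Hardy term.
  have dxx := dW.add_const_mul dv (1 - β)
  have bu : ∀ x ∈ Icc (0 : ℝ) 1, |sol β g x| ≤ 2 * q * E := fun x hx =>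
    (abs_sol_le_const hβ hg hx).trans hqE
  have bv : ∀ x ∈ Ioc (0 : ℝ) 1, |x ^ (-β) * sol β g x| ≤ 2 * q * E := fun x hx =>
    (abs_rpow_mul_sol_le hβ hg hx).trans hqE
  have eu : eLpNorm (sol β g) p (vol 0 1) ≤ ENNReal.ofReal (2 * q * E) :=
    eLpNorm_le_of_bound fun x hx => bu x (Ioo_subset_Icc_self hx)
  have eW : eLpNorm (flux β g) p (vol 0 1) ≤ ENNReal.ofReal (2 * E) :=
    eLpNorm_le_of_bound fun x hx => (abs_flux_le hβ hg (Ioo_subset_Icc_self hx)).trans (by linarith)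
  have eg : eLpNorm (fun x => -g x) p (vol 0 1) ≤ ENNReal.ofReal E :=
    (eLpNorm_neg g p _).trans_le hEp
  have ev : eLpNorm (fun x => x ^ (-β) * sol β g x) p (vol 0 1) ≤ ENNReal.ofReal (2 * q * E) :=
    eLpNorm_le_of_bound fun x hx => bv x (Ioo_subset_Ioc_self hx)
  have ev' : eLpNorm (fun x => -(x ^ (-β - 1) * ∫ t in (0 : ℝ)..x, t ^ β * g t)) p (vol 0 1)
      ≤ ENNReal.ofReal ((1 + q) * E) := by
    refine (eLpNorm_neg _ p _).trans_le ((eLpNorm_hardy_le hβ hp hgp.1).trans ?_)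
    rw [ENNReal.ofReal_mul (by positivity)]
    gcongr
  have ex : eLpNorm (fun x => x ^ (1 - β) * sol β g x) p (vol 0 1)
      ≤ ENNReal.ofReal (2 * q * E) := by
    refine eLpNorm_le_of_bound fun x hx => ?_
    have : x ^ (1 - β) * sol β g x = x * (x ^ (-β) * sol β g x) := by
      rw [sub_eq_add_neg, Real.rpow_add hx.1, Real.rpow_one, mul_assoc]
    rw [this, abs_mul, abs_of_pos hx.1]
    exact (mul_le_of_le_one_left (abs_nonneg _) hx.2.le).trans (bv x (Ioo_subset_Ioc_self hx))
  have mu := memLp_of_eLpNorm_le du.left eu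
  have mW := memLp_of_eLpNorm_le dW.left eW
  have mg := memLp_of_eLpNorm_le dW.right eg
  have mv := memLp_of_eLpNorm_le dv.left ev
  have mv' := memLp_of_eLpNorm_le dv.right ev'
  have mx := memLp_of_eLpNorm_le dx.left ex
  have ex' := eLpNorm_add_const_mul_le hp (by positivity) (by positivity) mW mv eW ev (1 - β)
  have ex'' := eLpNorm_add_const_mul_le hp (by positivity) (by positivity) mg mv' eg ev' (1 - β)
  have mx' := memLp_of_eLpNorm_le dx.right ex'
  have mx'' := memLp_of_eLpNorm_le dxx.right ex''
  refine ⟨memSobolevLoc_sol hβ hp hgp mu mW, ⟨mu, eu⟩, ⟨memSobolev_one dW mW mg,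
    memSobolev_one dv mv mv', ?_⟩, ⟨memSobolev_two dx dxx mx mx' mx'', ?_⟩, fun γ hγ => ?_, bv⟩
  · refine (add_le_add ((sobolevNorm_one_le dW).trans (add_le_add eW eg))
      ((sobolevNorm_one_le dv).trans (add_le_add ev ev'))).trans (le_of_eq ?_)
    rw [← ENNReal.ofReal_add, ← ENNReal.ofReal_add, ← ENNReal.ofReal_add] <;> try positivity
    congr 1; ring
  · refine ((sobolevNorm_two_le dx dxx).trans (add_le_add (add_le_add ex ex') ex'')).trans
      (le_of_eq ?_)
    rw [← ENNReal.ofReal_add, ← ENNReal.ofReal_add] <;> try positivity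
    congr 1; ring
  · refine (holderNorm_le (A := 2 * q * E) (B := 2 * (1 + q) * E) (by positivity) bu
      fun x y hx hxy hy => ?_).trans (le_of_eq ?_)
    · refine (abs_sol_sub_sol_le hβ hg hx hxy.le hy).trans ?_
      have h1 := hγ x y hx hxy hy
      have h2 : (y ^ β - x ^ β) / β ≤ (1 + q) * (y - x) ^ γ := by
        rw [div_le_iff₀ hβ]
        refine h1.trans (le_of_eq ?_)
        rw [hq]; field_simp; ring
      have h3 : 0 ≤ (1 + q) * (y - x) ^ γ :=
        mul_nonneg (by positivity) (Real.rpow_nonneg (by linarith) _)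
      calc _ ≤ (2 * ∫ s in (0 : ℝ)..1, |g s|) * ((1 + q) * (y - x) ^ γ) := by gcongr
        _ ≤ 2 * E * ((1 + q) * (y - x) ^ γ) := by gcongr
        _ = _ := by ring
    · rw [← ENNReal.ofReal_add (by positivity) (by positivity)]
      congr 1; ring

end SingularSL

/-! ### Assembly of the theorem. -/

open SingularSL in
theorem theorem1p1 (α : ℝ) (hα : α < 1 / 2) (hα0 : α ≠ 0) (p : ℝ≥0∞) (hp : 1 ≤ p) :
    ∃ C : ℝ≥0, ∀ f : ℝ → ℝ, MemLp f p (vol 0 1) →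
      ∃ u u' : ℝ → ℝ,
        -- existence; the value of `u` at `0` is its limit
        IsSolution α p f u u' ∧ Tendsto u (𝓝[>] 0) (𝓝 0) ∧ u 0 = 0 ∧
        -- uniqueness under the Dirichlet condition at the origin
        (∀ v v' : ℝ → ℝ, IsSolution α p f v v' → Tendsto v (𝓝[>] 0) (𝓝 0) →
          EqOn v u (Ioc 0 1)) ∧
        -- uniqueness in the regularity class (i)-(iii)
        (∀ v v' : ℝ → ℝ, IsSolution α p f v v' → MemLp v p (vol 0 1) →
          MemSobolev 1 p 0 1 (fun x => x ^ (2 * α) * v' x) →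
          MemSobolev 1 p 0 1 (fun x => x ^ (2 * α - 1) * v x) →
          MemSobolev 2 p 0 1 (fun x => x ^ (2 * α) * v x) →
          EqOn v u (Ioc 0 1)) ∧
        -- (i)
        (MemLp u p (vol 0 1) ∧ eLpNorm u p (vol 0 1) ≤ C * eLpNorm f p (vol 0 1)) ∧
        -- (ii)
        (MemSobolev 1 p 0 1 (fun x => x ^ (2 * α) * u' x) ∧
          MemSobolev 1 p 0 1 (fun x => x ^ (2 * α - 1) * u x) ∧
          sobolevNorm 1 p 0 1 (fun x => x ^ (2 * α) * u' x) +
            sobolevNorm 1 p 0 1 (fun x => x ^ (2 * α - 1) * u x) ≤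
              C * eLpNorm f p (vol 0 1)) ∧
        -- (iii)
        (MemSobolev 2 p 0 1 (fun x => x ^ (2 * α) * u x) ∧
          sobolevNorm 2 p 0 1 (fun x => x ^ (2 * α) * u x) ≤ C * eLpNorm f p (vol 0 1)) ∧
        -- (iv)
        (0 < α → holderNorm (1 / 2 - α) u ≤ C * eLpNorm f p (vol 0 1)) ∧
        -- (v)
        (α < 0 → holderNorm (1 / 2) u ≤ C * eLpNorm f p (vol 0 1)) ∧
        -- (vi)
        (∀ x ∈ Ioc (0 : ℝ) 1,
          |x ^ (2 * α - 1) * u x| ≤ C * (eLpNorm f p (vol 0 1)).toReal) := by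
  have hβ : 0 < 1 - 2 * α := by linarith
  obtain ⟨β, hβdef⟩ : ∃ β, β = 1 - 2 * α := ⟨_, rfl⟩
  rw [← hβdef] at hβ
  have e1 : 2 * α = 1 - β := by rw [hβdef]; ring
  have e2 : 2 * α - 1 = -β := by rw [hβdef]; ring
  set q := 1 / β with hq
  have hq0 : 0 < q := by positivity
  set D := 2 * (1 + β) / β ^ 2 with hD
  have hD0 : 0 < D := by positivity
  set c := |1 - β| with hc
  have hc0 : 0 ≤ c := abs_nonneg _
  -- The first factor is a crude common bound for the constants in `sol_estimates`; `1 + D` passes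
  -- from the norm of `g = f - u₀` to that of `f`.
  set K := (7 + 9 * q + c * (1 + 3 * q)) * (1 + D) with hK
  refine ⟨K.toNNReal, fun f hf => ?_⟩
  set F := (eLpNorm f p (vol 0 1)).toReal with hF
  have hF0 : 0 ≤ F := ENNReal.toReal_nonneg
  have hFe : eLpNorm f p (vol 0 1) = ENNReal.ofReal F := (ENNReal.ofReal_toReal hf.2.ne).symm
  have hfi := intervalIntegrable_of_memLp hp hf
  have hN := integral_abs_le_eLpNorm hp hf
  obtain ⟨u₀, hu₀c, hu₀s, hu₀b⟩ := exists_eq_sol_sub hβ hfi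
  have hu₀F : ∀ x, |u₀ x| ≤ D * F := fun x => (hu₀b x).trans (by gcongr)
  set g : ℝ → ℝ := fun t => f t - u₀ t with hg
  have hu₀m : MemLp u₀ p (vol 0 1) :=
    MemLp.of_bound hu₀c.aestronglyMeasurable (D * F) (.of_forall hu₀F)
  have hgp : MemLp g p (vol 0 1) := hf.sub hu₀m
  have hgi := intervalIntegrable_of_memLp hp hgp
  have hEp : eLpNorm g p (vol 0 1) ≤ ENNReal.ofReal ((1 + D) * F) := by
    refine (eLpNorm_sub_le hf.1 hu₀m.1 hp).trans ?_
    rw [add_mul, one_mul, ENNReal.ofReal_add hF0 (by positivity), hFe]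
    gcongr
    exact eLpNorm_le_of_bound fun x _ => hu₀F x
  have hE1 : ∫ s in (0 : ℝ)..1, |g s| ≤ (1 + D) * F :=
    (integral_abs_le_eLpNorm hp hgp).trans (ENNReal.toReal_le_of_le_ofReal (by positivity) hEp)
  obtain ⟨hloc, ⟨mu, eu⟩, ⟨mW, mv, eWv⟩, ⟨mx, ex⟩, hh, hv⟩ := sol_estimates hβ hp hgp hE1 hEp
  have hKF : ∀ {A : ℝ}, A ≤ 7 + 9 * q + c * (1 + 3 * q) → A * ((1 + D) * F) ≤ K * F := by
    intro A hA
    rw [hK, mul_assoc]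
    gcongr
  have hcq : 0 ≤ c * (1 + 3 * q) := by positivity
  have hfin : ∀ {A : ℝ}, A ≤ 7 + 9 * q + c * (1 + 3 * q) →
      ENNReal.ofReal (A * ((1 + D) * F)) ≤ K.toNNReal * eLpNorm f p (vol 0 1) := by
    intro A hA
    rw [hFe]
    change _ ≤ ENNReal.ofReal K * _
    rw [← ENNReal.ofReal_mul (by positivity)]
    exact ENNReal.ofReal_le_ofReal (hKF hA)
  have heq : EqOn (flux β g) (fun x => x ^ (2 * α) * (x ^ (β - 1) * flux β g x)) (Ioo 0 1) := by
    intro x hx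
    simp only
    rw [← mul_assoc, ← Real.rpow_add hx.1, e1]
    simp
  have hcont := continuousOn_sol hβ hgi
  have hsol : IsSolution α p f (sol β g) (fun x => x ^ (β - 1) * flux β g x) := by
    refine ⟨hcont.mono Ioc_subset_Icc_self, hloc, isWeakDeriv_sol hβ hgi,
      ⟨fun x => -g x, (isWeakDeriv_flux hgi).congr_on heq fun _ _ => rfl, ?_⟩, sol_one hβ hgi⟩
    filter_upwards [ae_restrict_mem measurableSet_Ioo] with x hx
    rw [← hu₀s x (Ioo_subset_Icc_self hx)]
    simp only [hg]
    ring
  have hlim : Tendsto (sol β g) (𝓝[>] 0) (𝓝 0) := by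
    have := hcont 0 (by simp)
    rw [ContinuousWithinAt, sol_zero] at this
    rw [← nhdsWithin_Ioc_eq_nhdsGT zero_lt_one]
    exact this.mono_left (nhdsWithin_mono _ Ioc_subset_Icc_self)
  -- The solution is taken as `sol β g`, which agrees with the fixed point `u₀` on `[0, 1]`, so that
  -- the linear estimates apply to it directly.
  refine ⟨sol β g, fun x => x ^ (β - 1) * flux β g x, hsol, hlim, sol_zero,
    fun v v' hv hv0 => hsol.eqOn hv hlim hv0,
    fun v v' hv _ _ hv1 _ => hsol.eqOn hv hlim (tendsto_zero_of_memSobolev hα hp hv.continuousOn hv1),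
    ⟨mu, eu.trans (hfin (by linarith))⟩, ⟨mW.congr_on heq, ?_, ?_⟩, ⟨?_, ?_⟩, fun h0 => ?_,
    fun h0 => ?_, fun x hx => ?_⟩
  · rwa [e2]
  · rw [e2]
    exact (add_le_add_left (sobolevNorm_le_of_eqOn heq) _).trans (eWv.trans (hfin (by linarith)))
  · rwa [e1]
  · rw [e1]
    exact ex.trans (hfin (by linarith))
  · refine (hh _ fun x y hx hxy hy => ?_).trans (hfin (by linarith))
    rw [show 1 / 2 - α = β / 2 by rw [hβdef]; ring]
    exact (rpow_sub_rpow_le_of_le_one hβ (by linarith) hx hxy hy).trans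
      (le_mul_of_one_le_left (Real.rpow_nonneg (by linarith) _) (by linarith))
  · refine (hh _ fun x y hx hxy hy => ?_).trans (hfin (by linarith))
    refine (rpow_sub_rpow_le_of_one_le (by linarith) hx hxy hy).trans ?_
    gcongr
    linarith
  · rw [e2]
    refine (hv x hx).trans ((hKF (by linarith)).trans ?_)
    exact mul_le_mul_of_nonneg_right (Real.le_coe_toNNReal K) hF0
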